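/- Let $\Lambda>0$. There are constants $\tilde c_1,\tilde c_2,\ldots<\infty$, with $\tilde c_l$ depending only on $l$ and $\Lambda$, such that the following holds. Let $(\mathbf M,g)$ be a smooth finite-dimensional Riemannian manifold (without boundary) with Levi-Civita connection $\nabla$ and curvature tensor $R$, which is locally symmetric, i.e. $\nabla R=0$, and satisfies Condition $(\Lambda)$: $R(X,Y,Z,W)=\langle R(X,Y)Z,W\rangle\le\Lambda$ for all unit vectors $X,Y,Z,W$ tangent to $\mathbf M$ at a common point. Let $J\subset\mathbb R$ be an interval and let $\gamma:\mathbf S^1\times J\to\mathbf M$ be a curve shortening flow, i.e. a smooth map such that every $\gamma_t=\gamma(\cdot,t)$ is an immersion and $$\frac{\partial\gamma}{\partial t}=\frac{DT}{\partial s},$$ where, with $u$ the angular parameter on $\mathbf S^1$ and $v=|\partial\gamma/\partial u|$, $T=\frac1v\frac{\partial\gamma}{\partial u}$ is the unit tangent vector and $\frac{D}{\partial s}=\frac1v\nabla_u$ is covariant differentiation along $\gamma_t$ with respect to arc length. Put $k^2=\left|\frac{DT}{\partial s}\right|^2$. Fix $t_0\in J$ and let $M_{t_0}=\max_{\mathbf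 S^1}k^2(\cdot,t_0)$. Then for every $t\in J$ with $$t_0<t\le t_0+\frac1{2\Lambda}\log\Bigl(1+\frac{\Lambda}{4M_{t_0}+\Lambda+1}\Bigr),$$ one has at every point of $\mathbf S^1$, for every integer $l\ge1$, $$\left|\frac{D^lT}{\partial s^l}\right|^2(\cdot,t)\le\frac{\tilde c_l\,M_{t_0}}{(t-t_0)^{l-1}},$$ and moreover $k^2(\cdot,t)\le 2M_{t_0}$. -/

import Mathlib

open Set Bundle Manifold
open scoped ContDiff

noncomputable section

namespace CSF

variable {E : Type*} [NormedAddCommGroup E] [NormedSpace ℝ E]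
  {M : Type*} [TopologicalSpace M] [ChartedSpace E M]

section Charts

variable [RiemannianBundle (fun x : M ↦ TangentSpace 𝓘(ℝ, E) x)]

/-- The Riemannian metric in the chart `φ` at `x₀`: for `y` in the target of `φ`,
`metric x₀ y v w` is the inner product of `dφ⁻¹(y) v` and `dφ⁻¹(y) w`. -/
def metric (x₀ : M) (y : E) : E →L[ℝ] E →L[ℝ] ℝ :=
  ContinuousLinearMap.bilinearComp
    (innerSL ℝ (E := TangentSpace 𝓘(ℝ, E) ((extChartAt 𝓘(ℝ, E) x₀).symm y)))
    (mfderiv 𝓘(ℝ, E) 𝓘(ℝ, E) (extChartAt 𝓘(ℝ, E) x₀).symm y)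
    (mfderiv 𝓘(ℝ, E) 𝓘(ℝ, E) (extChartAt 𝓘(ℝ, E) x₀).symm y)

theorem metric_apply (x₀ : M) (y v w : E) :
    metric x₀ y v w = inner ℝ
      (mfderiv 𝓘(ℝ, E) 𝓘(ℝ, E) (extChartAt 𝓘(ℝ, E) x₀).symm y v)
      (mfderiv 𝓘(ℝ, E) 𝓘(ℝ, E) (extChartAt 𝓘(ℝ, E) x₀).symm y w) :=
  rfl

/-- The functional `z ↦ ½ (∂_v g(w, z) + ∂_w g(v, z) - ∂_z g(v, w))` in the chart at `x₀`
(Christoffel symbols of the first kind). -/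
def christoffelLower (x₀ : M) (y v w : E) : E →L[ℝ] ℝ :=
  (1 / 2 : ℝ) • (fderiv ℝ (metric x₀) y v w + fderiv ℝ (metric x₀) y w v
    - ((fderiv ℝ (metric x₀) y).flip v).flip w)

/-- The Christoffel symbols (of the second kind) of the Levi-Civita connection in the chart at
`x₀`: `christoffel x₀ y v w` has coordinates `Γ^k_{ij}(y) v^i w^j`. The index is raised with the
inverse of the metric, seen as a map from `E` to its dual. -/
def christoffel (x₀ : M) (y v w : E) : E :=
  (metric x₀ y).inverse (christoffelLower x₀ y v w)

/-- The curvature operator `R(v, w) z = ∇_w ∇_v z - ∇_v ∇_w z + ∇_{[v, w]} z` in the chart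
at `x₀`. -/
def curvature (x₀ : M) (y v w z : E) : E :=
  fderiv ℝ (fun y' ↦ christoffel x₀ y' v z) y w - fderiv ℝ (fun y' ↦ christoffel x₀ y' w z) y v
    + christoffel x₀ y w (christoffel x₀ y v z) - christoffel x₀ y v (christoffel x₀ y w z)

/-- The covariant derivative `(∇_a R)(v, w) z` of the curvature in the chart at `x₀`. -/
def covDerivCurvature (x₀ : M) (y a v w z : E) : E :=
  fderiv ℝ (fun y' ↦ curvature x₀ y' v w z) y a + christoffel x₀ y a (curvature x₀ y v w z)
    - curvature x₀ y (christoffel x₀ y a v) w z - curvature x₀ y v (christoffel x₀ y a w) z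
    - curvature x₀ y v w (christoffel x₀ y a z)

variable (E M) in
/-- `M` is locally symmetric: `∇ R = 0`. -/
def IsLocallySymmetric : Prop :=
  ∀ x₀ : M, ∀ y ∈ (extChartAt 𝓘(ℝ, E) x₀).target, ∀ a v w z : E,
    covDerivCurvature x₀ y a v w z = 0

variable (E M) in
/-- Condition (Λ): `R(X, Y, Z, W) = ⟨R(X, Y) Z, W⟩ ≤ Λ` for all unit vectors `X, Y, Z, W` tangent
to `M` at a common point. -/
def ConditionLambda (Λ : ℝ) : Prop :=
  ∀ x₀ : M, ∀ y ∈ (extChartAt 𝓘(ℝ, E) x₀).target, ∀ X Y Z W : E,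
    metric x₀ y X X = 1 → metric x₀ y Y Y = 1 → metric x₀ y Z Z = 1 → metric x₀ y W W = 1 →
    metric x₀ y (curvature x₀ y X Y Z) W ≤ Λ

end Charts

section Curves

/-- The velocity `dc/du` of a curve. -/
def velocity (c : ℝ → M) (u : ℝ) : TangentSpace 𝓘(ℝ, E) (c u) :=
  mfderiv 𝓘(ℝ, ℝ) 𝓘(ℝ, E) c u (1 : ℝ)

/-- The coordinate expression, in the chart at `x₀`, of a vector field along `c`. -/
def coordField (x₀ : M) (c : ℝ → M) (V : ∀ u, TangentSpace 𝓘(ℝ, E) (c u)) (u : ℝ) : E :=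
  mfderiv 𝓘(ℝ, E) 𝓘(ℝ, E) (extChartAt 𝓘(ℝ, E) x₀) (c u) (V u)

variable [RiemannianBundle (fun x : M ↦ TangentSpace 𝓘(ℝ, E) x)]

/-- The covariant derivative `DV/∂u` of a vector field along `c`: in the chart at `c u`, it is
`dV/du + Γ(dc/du, V)`. -/
def covDeriv (c : ℝ → M) (V : ∀ u, TangentSpace 𝓘(ℝ, E) (c u)) (u : ℝ) :
    TangentSpace 𝓘(ℝ, E) (c u) :=
  (mfderiv 𝓘(ℝ, E) 𝓘(ℝ, E) (extChartAt 𝓘(ℝ, E) (c u)) (c u)).inverse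
    (deriv (coordField (c u) c V) u +
      christoffel (c u) (extChartAt 𝓘(ℝ, E) (c u) (c u))
        (coordField (c u) c (velocity c) u) (coordField (c u) c V u))

/-- `DV/∂s = (1/v) DV/∂u`, where `v = |dc/du|` is the speed. -/
def covDerivS (c : ℝ → M) (V : ∀ u, TangentSpace 𝓘(ℝ, E) (c u)) (u : ℝ) :
    TangentSpace 𝓘(ℝ, E) (c u) :=
  ‖velocity (E := E) c u‖⁻¹ • covDeriv c V u

/-- The unit tangent vector `T = (1/v) dc/du`. -/
def unitTangent (c : ℝ → M) (u : ℝ) : TangentSpace 𝓘(ℝ, E) (c u) :=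
  ‖velocity (E := E) c u‖⁻¹ • velocity c u

/-- The iterated covariant derivative `D^l T/∂s^l`. -/
def iterCovDerivT (c : ℝ → M) (l : ℕ) : ∀ u, TangentSpace 𝓘(ℝ, E) (c u) :=
  (covDerivS c)^[l] (unitTangent c)

/-- The closed curve `γ_t`, as a (periodic) function of the angle `u`. -/
def slice (γ : Circle × ℝ → M) (t : ℝ) (u : ℝ) : M := γ (Circle.exp u, t)

variable (E) in
/-- `γ` is a curve shortening flow on the time interval `J`: a smooth family of immersed closed
curves with `∂γ/∂t = DT/∂s`. (At an endpoint belonging to `J` the time derivative is one-sided.) -/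
structure IsCurveShorteningFlow (J : Set ℝ) (γ : Circle × ℝ → M) : Prop where
  smooth : ContMDiffOn ((𝓡 1).prod 𝓘(ℝ, ℝ)) 𝓘(ℝ, E) ∞ γ (univ ×ˢ J)
  immersed : ∀ t ∈ J, ∀ u : ℝ, velocity (E := E) (slice γ t) u ≠ 0
  evolution : ∀ t ∈ J, ∀ u : ℝ,
    HasMFDerivWithinAt 𝓘(ℝ, ℝ) 𝓘(ℝ, E) (fun τ ↦ slice γ τ u) J t
      (ContinuousLinearMap.toSpanSingleton ℝ (iterCovDerivT (E := E) (slice γ t) 1 u))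

end Curves

end CSF

end

/-!
Write `A_l = D^l T/∂s^l`. As `∇R = 0`, differentiating the commutation formula for `D_t` and `D/∂s`
never produces derivatives of the curvature, so that `D_t A_l = A_{l+2} + Q_l`, where `Q_l` is a sum
of monomials `⟨A_i, A_j⟩ A_m` and `R(A_i, A_j) A_m` in the `A_j` alone. All estimates can therefore
be carried out on the functions `⟨A_i, A_j⟩`, which are periodic in the angle.

For `k² = |A_1|²` this gives `∂_t k² ≤ ∂_s² k² + 2 k⁴ + 2 Λ k²`, as `|A_2|² ≥ ⟨A_0, A_2⟩² = k⁴`,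
hence a bound by the solution of an ordinary differential equation. The bounds on `|A_l|²` follow
by induction on `l`, applying the maximum principle to
`τ^{n+2} |A_{n+2}|² + B τ^{n+1} |A_{n+1}|²` with `τ = t - t₀`: the evolution of the second summand
provides a term `-2 B τ^{n+1} |A_{n+2}|²`, which for large `B` absorbs the bad terms of the
evolution of the first.
-/

noncomputable section

namespace CSF

/-- The monomials in the derivatives `A_l = D^l T/∂s^l` occurring in their evolution equations:
`gram i j m` stands for `⟨A_{i+1}, A_{j+1}⟩ A_m` and `curv i j m` for `R(A_i, A_{j+1}) A_m`. The
shifts by one make every index triple occur. -/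
inductive ReactionTerm
  | gram (i j m : ℕ)
  | curv (i j m : ℕ)

namespace ReactionTerm

/-- The arc length derivative of a monomial, as a list of monomials (by the product rule, as
`∇R = 0`). -/
def derivative : ReactionTerm → List ReactionTerm
  | gram i j m => [gram (i + 1) j m, gram i (j + 1) m, gram i j (m + 1)]
  | curv i j m => [curv (i + 1) j m, curv i (j + 1) m, curv i j (m + 1)]

/-- The weight of a monomial: the number of derivatives in excess of that of `⟨A_1, A_1⟩ A_0`,
where the curvature tensor counts as two derivatives. -/
def weight : ReactionTerm → ℕ
  | gram i j m => i + j + m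
  | curv i j m => i + j + m + 1

/-- A bound for the inner product of a monomial with `A_l`, in terms of the Gram matrix
`N i j = ⟨A_i, A_j⟩` and a bound `Λ` for the curvature. -/
def bound (Λ : ℝ) (N : ℕ → ℕ → ℝ) (l : ℕ) : ReactionTerm → ℝ
  | gram i j m => |N (i + 1) (j + 1)| * |N m l|
  | curv i j m => Λ * (√(N i i) * √(N (j + 1) (j + 1)) * √(N m m) * √(N l l))

theorem weight_of_mem_derivative {q r : ReactionTerm} (h : q ∈ r.derivative) :
    q.weight = r.weight + 1 := by
  cases r <;> simp only [derivative, List.mem_cons, List.not_mem_nil, or_false] at h <;>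
    rcases h with rfl | rfl | rfl <;> simp only [weight] <;> omega

end ReactionTerm

/-- The reaction part `Q_l` of the evolution equation `D_t A_l = A_{l+2} + Q_l`, as a list of
monomials. The two terms added in each step come from commuting `D_t` with `D/∂s`. -/
def reaction : ℕ → List ReactionTerm
  | 0 => [.gram 0 0 0]
  | l + 1 => (reaction l).flatMap ReactionTerm.derivative ++ [.gram 0 0 (l + 1), .curv 0 0 l]

theorem weight_of_mem_reaction {l : ℕ} {q : ReactionTerm} (hq : q ∈ reaction l) :
    q.weight = l := by
  induction l generalizing q with
  | zero =>
    obtain rfl := List.mem_singleton.1 hq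
    rfl
  | succ l ih =>
    simp only [reaction, List.mem_append, List.mem_flatMap, List.mem_cons, List.not_mem_nil,
      or_false] at hq
    rcases hq with ⟨r, hr, hq⟩ | rfl | rfl
    · rw [ReactionTerm.weight_of_mem_derivative hq, ih hr]
    · simp only [ReactionTerm.weight, zero_add]
    · simp only [ReactionTerm.weight, zero_add]

/-- A bound for `⟨Q_l, A_l⟩` in terms of the Gram matrix `N` of the `A_j`. -/
def reactionBound (Λ : ℝ) (N : ℕ → ℕ → ℝ) (l : ℕ) : ℝ :=
  ((reaction l).map (ReactionTerm.bound Λ N l)).sum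

/-- The relations between the inner products `N i j = ⟨A_i, A_j⟩` at a point of a curve: those of
a Gram matrix, and those obtained by differentiating `|T|² = 1`. -/
structure IsTangentGram (N : ℕ → ℕ → ℝ) : Prop where
  symm : ∀ i j, N i j = N j i
  abs_le : ∀ i j, |N i j| ≤ √(N i i) * √(N j j)
  zero_zero : N 0 0 = 1
  zero_one : N 0 1 = 0
  zero_two : N 0 2 = -N 1 1

namespace IsTangentGram

variable {N : ℕ → ℕ → ℝ}

theorem nonneg (h : IsTangentGram N) (l : ℕ) : 0 ≤ N l l := by
  by_contra! hneg
  have hle := h.abs_le l l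
  rw [Real.sqrt_eq_zero_of_nonpos hneg.le, mul_zero] at hle
  exact hneg.ne (abs_nonpos_iff.1 hle)

theorem sq_le (h : IsTangentGram N) : N 1 1 ^ 2 ≤ N 2 2 := by
  have hle := h.abs_le 0 2
  rw [h.zero_zero, h.zero_two, abs_neg, abs_of_nonneg (h.nonneg 1), Real.sqrt_one, one_mul] at hle
  exact (Real.le_sqrt (h.nonneg 1) (h.nonneg 2)).1 hle

theorem reactionBound_one (h : IsTangentGram N) (Λ : ℝ) :
    reactionBound Λ N 1 = 2 * N 1 1 ^ 2 + Λ * N 1 1 := by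
  have h11 : √(N 1 1) * √(N 1 1) = N 1 1 := Real.mul_self_sqrt (h.nonneg 1)
  simp only [reactionBound, reaction, ReactionTerm.derivative, ReactionTerm.bound,
    List.flatMap_cons, List.flatMap_nil, List.append_nil, List.cons_append, List.nil_append,
    List.map_cons, List.map_nil, List.sum_cons, List.sum_nil, zero_add, one_add_one_eq_two,
    h.zero_one, h.zero_zero, abs_zero, mul_zero, abs_of_nonneg (h.nonneg 1), Real.sqrt_one,
    one_mul, mul_one, h11]
  ring

end IsTangentGram

section MaximumPrinciple

theorem deriv_eq_zero_and_deriv_nonpos_of_max {f f' : ℝ → ℝ} {f'' u : ℝ}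
    (hf : ∀ x, HasDerivAt f (f' x) x) (hf' : HasDerivAt f' f'' u) (hmax : ∀ x, f x ≤ f u) :
    f' u = 0 ∧ f'' ≤ 0 := by
  have hderiv : deriv f = f' := funext fun x ↦ (hf x).deriv
  have hcrit : f' u = 0 := IsLocalMax.hasDerivAt_eq_zero (Filter.Eventually.of_forall hmax) (hf u)
  refine ⟨hcrit, ?_⟩
  by_contra! hpos
  have hmin : IsLocalMin f u := isLocalMin_of_deriv_deriv_pos
    (by rwa [hderiv, hf'.deriv]) (by rw [hderiv, hcrit]) (hf u).continuousAt
  have hconst : f =ᶠ[nhds u] fun _ ↦ f u := hmin.mono fun x hx ↦ le_antisymm (hmax x) hx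
  have hf'0 : deriv f =ᶠ[nhds u] fun _ ↦ 0 := by
    simpa only [deriv_const'] using hconst.deriv
  rw [hderiv] at hf'0
  exact hpos.ne' ((hf'.congr_of_eventuallyEq hf'0.symm).unique (hasDerivAt_const u 0))

theorem exists_isMaxOn_of_periodic {f : ℝ × ℝ → ℝ} {p t₀ t₁ : ℝ} (hp : 0 < p) (ht : t₀ ≤ t₁)
    (hper : ∀ t ∈ Icc t₀ t₁, Function.Periodic (fun u ↦ f (u, t)) p)
    (hf : ContinuousOn f (univ ×ˢ Icc t₀ t₁)) :
    ∃ x ∈ univ ×ˢ Icc t₀ t₁, IsMaxOn f (univ ×ˢ Icc t₀ t₁) x := by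
  have hsub : Icc 0 p ×ˢ Icc t₀ t₁ ⊆ univ ×ˢ Icc t₀ t₁ := prod_mono (subset_univ _) subset_rfl
  obtain ⟨x, hx, hmax⟩ := (isCompact_Icc.prod isCompact_Icc).exists_isMaxOn
    ⟨(0, t₀), ⟨le_rfl, hp.le⟩, le_rfl, ht⟩ (hf.mono hsub)
  refine ⟨x, hsub hx, ?_⟩
  rintro ⟨u, t⟩ ⟨-, ht⟩
  obtain ⟨u', hu', huu'⟩ := (hper t ht).exists_mem_Ico₀ hp u
  exact huu'.trans_le (hmax ⟨Ico_subset_Icc_self hu', ht⟩)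

theorem derivative_nonneg_of_isMaxOn_Icc {f : ℝ → ℝ} {f' t₀ t : ℝ} (ht : t₀ < t)
    (hf : HasDerivAt f f' t) (hmax : IsMaxOn f (Icc t₀ t) t) : 0 ≤ f' := by
  have hcone : t₀ - t ∈ posTangentConeAt (Icc t₀ t) t :=
    sub_mem_posTangentConeAt_of_segment_subset
      ((convex_Icc t₀ t).segment_subset (right_mem_Icc.2 ht.le) (left_mem_Icc.2 ht.le))
  have hle := hmax.localize.hasFDerivWithinAt_nonpos hf.hasFDerivAt.hasFDerivWithinAt hcone
  rw [ContinuousLinearMap.toSpanSingleton_apply, smul_eq_mul] at hle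
  nlinarith

theorem hasDerivAt_exp_mul_sub (a t₀ t : ℝ) :
    HasDerivAt (fun s ↦ Real.exp (a * (s - t₀))) (Real.exp (a * (t - t₀)) * a) t := by
  simpa only [mul_one] using (((hasDerivAt_id' t).sub_const t₀).const_mul a).exp

variable {w : ℝ → ℝ → ℝ} {p t₀ t₁ C : ℝ}

-- A positive maximum of `exp (-(C + 1) (t - t₀)) w` would violate the differential inequality.
theorem nonpos_of_deriv_le_of_max_Ioc (hp : 0 < p)
    (hper : ∀ t ∈ Icc t₀ t₁, Function.Periodic (fun u ↦ w u t) p)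
    (hcont : ContinuousOn (fun x : ℝ × ℝ ↦ w x.1 x.2) (univ ×ˢ Icc t₀ t₁))
    (hinit : ∀ u, w u t₀ ≤ 0)
    (hderiv : ∀ t ∈ Ioc t₀ t₁, ∀ u, 0 < w u t → (∀ u', w u' t ≤ w u t) →
      ∃ d, HasDerivAt (w u) d t ∧ d ≤ C * w u t)
    {t : ℝ} (ht : t ∈ Icc t₀ t₁) (u : ℝ) : w u t ≤ 0 := by
  by_contra! hpos
  set e : ℝ → ℝ := fun s ↦ Real.exp (-(C + 1) * (s - t₀))
  have he : ∀ s, 0 < e s := fun s ↦ Real.exp_pos _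
  obtain ⟨⟨u₁, s⟩, ⟨-, hs⟩, hmax⟩ := exists_isMaxOn_of_periodic (f := fun x ↦ e x.2 * w x.1 x.2) hp
    (ht.1.trans ht.2) (fun s hs u ↦ congrArg (e s * ·) (hper s hs u))
    (ContinuousOn.mul (by fun_prop) hcont)
  have hle : ∀ r ∈ Icc t₀ t₁, ∀ x, e r * w x r ≤ e s * w u₁ s := fun r hr x ↦
    hmax (show (x, r) ∈ univ ×ˢ Icc t₀ t₁ from ⟨mem_univ x, hr⟩)
  have hwpos : 0 < w u₁ s :=
    pos_of_mul_pos_right ((mul_pos (he t) hpos).trans_le (hle t ht u)) (he s).le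
  have hs0 : t₀ < s := hs.1.lt_of_ne fun h ↦ (hinit u₁).not_gt (h ▸ hwpos)
  obtain ⟨d, hd, hdle⟩ := hderiv s ⟨hs0, hs.2⟩ u₁ hwpos fun x ↦
    le_of_mul_le_mul_left (hle s hs x) (he s)
  have hed := (hasDerivAt_exp_mul_sub (-(C + 1)) t₀ s).mul hd
  have hnonneg := derivative_nonneg_of_isMaxOn_Icc hs0 hed fun x hx ↦
    hle x ⟨hx.1, hx.2.trans hs.2⟩ u₁
  have hneg : e s * (d - (C + 1) * w u₁ s) < 0 := mul_neg_of_pos_of_neg (he s) (by linarith)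
  linarith

theorem nonpos_of_deriv_le_of_max (hp : 0 < p)
    (hper : ∀ t ∈ Icc t₀ t₁, Function.Periodic (fun u ↦ w u t) p)
    (hcont : ContinuousOn (fun x : ℝ × ℝ ↦ w x.1 x.2) (univ ×ˢ Icc t₀ t₁))
    (hinit : ∀ u, w u t₀ ≤ 0)
    (hderiv : ∀ t ∈ Ioo t₀ t₁, ∀ u, 0 < w u t → (∀ u', w u' t ≤ w u t) →
      ∃ d, HasDerivAt (w u) d t ∧ d ≤ C * w u t)
    {t : ℝ} (ht : t ∈ Icc t₀ t₁) (u : ℝ) : w u t ≤ 0 := by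
  have hIco : ∀ t ∈ Ico t₀ t₁, w u t ≤ 0 := fun t ht ↦ by
    have hsub : Icc t₀ t ⊆ Icc t₀ t₁ := Icc_subset_Icc_right ht.2.le
    exact nonpos_of_deriv_le_of_max_Ioc hp (fun s hs ↦ hper s (hsub hs))
      (hcont.mono (prod_mono subset_rfl hsub)) hinit
      (fun s hs ↦ hderiv s ⟨hs.1, hs.2.trans_lt ht.2⟩) (right_mem_Icc.2 ht.1) u
  rcases ht.1.eq_or_lt with rfl | hlt
  · exact hinit u
  have hclosure : closure (Ico t₀ t₁) = Icc t₀ t₁ := closure_Ico (hlt.trans_le ht.2).ne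
  refine le_on_closure hIco ?_ continuousOn_const (hclosure ▸ ht)
  rw [hclosure]
  exact hcont.comp (f := fun s ↦ (u, s)) (by fun_prop) fun s hs ↦ ⟨mem_univ u, hs⟩

end MaximumPrinciple

section ReactionEstimate

/-- The bounds on the sequence of scaled norms `X j = τ^{j/2} |A_j|` under which the reaction terms
of order `l` are estimated; `ε` stands for the scaled curvature `τ^{1/2} sup |A_1|`. -/
structure HasLowerOrderBounds (X : ℕ → ℝ) (K ε : ℝ) (l : ℕ) : Prop where
  nonneg : ∀ j, 0 ≤ X j
  one_le : 1 ≤ K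
  le : ∀ j < max l 2, X j ≤ K
  le_mul : ∀ j, 1 ≤ j → j < l → X j ≤ K * ε

namespace HasLowerOrderBounds

variable {X : ℕ → ℝ} {K ε : ℝ} {l : ℕ}

theorem mul_le (h : HasLowerOrderBounds X K ε l) {p : ℕ} (hp : 1 ≤ p) (hpl : p ≤ l + 1) :
    X p * X l ≤ K * (X (l + 1) * X l + X l ^ 2 + ε ^ 2) := by
  have hK := h.one_le
  have hprod : 0 ≤ X (l + 1) * X l := mul_nonneg (h.nonneg _) (h.nonneg _)
  have hsum : 0 ≤ X (l + 1) * X l + X l ^ 2 + ε ^ 2 := by positivity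
  rcases hpl.eq_or_lt with rfl | hpl
  · nlinarith [sq_nonneg (X l), sq_nonneg ε]
  rcases (Nat.lt_succ_iff.1 hpl).eq_or_lt with rfl | hpl
  · nlinarith [sq_nonneg ε]
  calc X p * X l ≤ K * ε * X l := by gcongr; exacts [h.nonneg l, h.le_mul p hp hpl]
    _ = K * (ε * X l) := mul_assoc _ _ _
    _ ≤ K * (X (l + 1) * X l + X l ^ 2 + ε ^ 2) := by
      gcongr
      nlinarith [sq_nonneg (X l - ε), sq_nonneg (X l), sq_nonneg ε]

theorem mul_mul_mul_le (h : HasLowerOrderBounds X K ε l) {p q r : ℕ} (hp : 1 ≤ p)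
    (hpl : p ≤ l + 1) (hq : q < max l 2) (hr : r < max l 2) :
    X p * X q * X r * X l ≤ K ^ 3 * (X (l + 1) * X l + X l ^ 2 + ε ^ 2) := by
  have hK : 0 ≤ K := zero_le_one.trans h.one_le
  calc X p * X q * X r * X l = X q * X r * (X p * X l) := by ring
    _ ≤ K * K * (K * (X (l + 1) * X l + X l ^ 2 + ε ^ 2)) :=
      mul_le_mul (mul_le_mul (h.le q hq) (h.le r hr) (h.nonneg r) hK) (h.mul_le hp hpl)
        (mul_nonneg (h.nonneg p) (h.nonneg l)) (mul_nonneg hK hK)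
    _ = K ^ 3 * (X (l + 1) * X l + X l ^ 2 + ε ^ 2) := by ring

theorem gram_mul_le (h : HasLowerOrderBounds X K ε l) (hl : 1 ≤ l) {i j m : ℕ}
    (hw : i + j + m = l) (hne : ¬(i = 1 ∧ j = 1 ∧ m = 0)) :
    X (i + 1) * X (j + 1) * X m * X l ≤ K ^ 3 * (X (l + 1) * X l + X l ^ 2 + ε ^ 2) := by
  by_cases hm : max l 2 ≤ m
  · calc X (i + 1) * X (j + 1) * X m * X l = X m * X (i + 1) * X (j + 1) * X l := by ring
      _ ≤ _ := h.mul_mul_mul_le (by lia) (by lia) (by lia) (by lia)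
  by_cases hi : max l 2 ≤ i + 1
  · exact h.mul_mul_mul_le (by lia) (by lia) (by lia) (by lia)
  calc X (i + 1) * X (j + 1) * X m * X l = X (j + 1) * X (i + 1) * X m * X l := by ring
    _ ≤ _ := h.mul_mul_mul_le (by lia) (by lia) (by lia) (by lia)

theorem curv_mul_le (h : HasLowerOrderBounds X K ε l) {i j m : ℕ} (hw : i + j + m + 1 = l) :
    X i * X (j + 1) * X m * X l ≤ K ^ 3 * (X (l + 1) * X l + X l ^ 2 + ε ^ 2) := by
  calc X i * X (j + 1) * X m * X l = X (j + 1) * X i * X m * X l := by ring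
    _ ≤ _ := h.mul_mul_mul_le (by lia) (by lia) (by lia) (by lia)

end HasLowerOrderBounds

/-- The scaled norm `τ^{j/2} |A_j|`, in terms of the Gram matrix `N` of the `A_j`. -/
def scaledNorm (τ : ℝ) (N : ℕ → ℕ → ℝ) (j : ℕ) : ℝ := √τ ^ j * √(N j j)

/-- The situation at one point and one time in which the reaction terms of order `k + 1` are
estimated: `τ` is the time elapsed, `M` the initial bound for `N 1 1 = k²`, and the derivatives of
order at most `k` are already controlled. -/
structure IsEstimatePoint (Λ τ M K : ℝ) (N : ℕ → ℕ → ℝ) (k : ℕ) : Prop where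
  gram : IsTangentGram N
  curvature_nonneg : 0 ≤ Λ
  time_pos : 0 < τ
  one_le : 1 ≤ K
  time_mul_le : τ * M ≤ 1 / 8
  time_mul_curvature_le : τ * Λ ≤ 1 / 2
  le_two_mul : N 1 1 ≤ 2 * M
  lower : ∀ j < k, τ ^ j * N (j + 1) (j + 1) ≤ K * M

/-- The constant in the estimate of the reaction terms of order `l`. -/
def reactionConst (l : ℕ) (K : ℝ) : ℝ :=
  ((reaction l).length * K ^ 3) ^ 2 + 2 * ((reaction l).length * K ^ 3)

theorem reactionConst_nonneg (l : ℕ) {K : ℝ} (hK : 0 ≤ K) : 0 ≤ reactionConst l K := by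
  unfold reactionConst
  positivity

namespace IsEstimatePoint

variable {Λ τ M K : ℝ} {N : ℕ → ℕ → ℝ} {k : ℕ}

theorem bound_nonneg (h : IsEstimatePoint Λ τ M K N k) : 0 ≤ M := by
  linarith [h.gram.nonneg 1, h.le_two_mul]

theorem scaledNorm_sq (h : IsEstimatePoint Λ τ M K N k) (j : ℕ) :
    scaledNorm τ N j ^ 2 = τ ^ j * N j j := by
  rw [scaledNorm, mul_pow, Real.sq_sqrt (h.gram.nonneg j), pow_right_comm,
    Real.sq_sqrt h.time_pos.le]

theorem scaledNorm_one_le (h : IsEstimatePoint Λ τ M K N k) : scaledNorm τ N 1 ≤ K := by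
  have hsq : scaledNorm τ N 1 ^ 2 ≤ 1 := by
    rw [h.scaledNorm_sq, pow_one]
    nlinarith [h.le_two_mul, h.time_mul_le, h.time_pos]
  exact (abs_le_of_sq_le_sq' (by rwa [one_pow]) zero_le_one).2.trans h.one_le

theorem hasLowerOrderBounds (h : IsEstimatePoint Λ τ M K N k) :
    HasLowerOrderBounds (scaledNorm τ N) K √(τ * M) (k + 1) := by
  have hK := h.one_le
  have hτM : 0 ≤ τ * M := mul_nonneg h.time_pos.le h.bound_nonneg
  have hε : √(τ * M) ≤ 1 := Real.sqrt_le_one.2 (by linarith [h.time_mul_le])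
  have hle_mul : ∀ j, 1 ≤ j → j < k + 1 → scaledNorm τ N j ≤ K * √(τ * M) := by
    rintro (_ | j) h1 hj
    · simp at h1
    refine (abs_le_of_sq_le_sq' ?_ (by positivity)).2
    calc scaledNorm τ N (j + 1) ^ 2 = τ * (τ ^ j * N (j + 1) (j + 1)) := by
          rw [h.scaledNorm_sq]; ring
      _ ≤ τ * (K * M) := mul_le_mul_of_nonneg_left (h.lower j (by lia)) h.time_pos.le
      _ ≤ K ^ 2 * (τ * M) := by nlinarith [mul_nonneg (sub_nonneg.2 hK) hτM]
      _ = (K * √(τ * M)) ^ 2 := by rw [mul_pow, Real.sq_sqrt hτM]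
  refine ⟨fun j ↦ by unfold scaledNorm; positivity, hK, fun j hj ↦ ?_, hle_mul⟩
  rcases lt_trichotomy j 1 with h0 | rfl | h1
  · obtain rfl : j = 0 := by lia
    rwa [scaledNorm, h.gram.zero_zero, pow_zero, Real.sqrt_one, one_mul]
  · exact h.scaledNorm_one_le
  · exact (hle_mul j h1.le (by lia)).trans (mul_le_of_le_one_right (by linarith) hε)

theorem pow_mul_gram_le (h : IsEstimatePoint Λ τ M K N k) {i j m : ℕ} (hw : i + j + m = k + 1) :
    τ ^ (k + 2) * ReactionTerm.bound Λ N (k + 1) (.gram i j m) ≤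
      K ^ 3 * (scaledNorm τ N (k + 2) * scaledNorm τ N (k + 1) + scaledNorm τ N (k + 1) ^ 2 +
        √(τ * M) ^ 2) := by
  have hX := h.hasLowerOrderBounds
  have hτ := h.time_pos
  have hK := h.one_le
  simp only [ReactionTerm.bound]
  by_cases hne : i = 1 ∧ j = 1 ∧ m = 0
  · obtain ⟨rfl, rfl, rfl⟩ := hne
    obtain rfl : k = 1 := by lia
    have hprod : 0 ≤ scaledNorm τ N 3 * scaledNorm τ N 2 := mul_nonneg (hX.nonneg _) (hX.nonneg _)
    -- the only term with two factors of top order, rescued by `⟨A_0, A_2⟩ = -|A_1|²`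
    calc τ ^ 3 * (|N 2 2| * |N 0 2|) = scaledNorm τ N 1 ^ 2 * scaledNorm τ N 2 ^ 2 := by
          rw [h.gram.zero_two, abs_neg, abs_of_nonneg (h.gram.nonneg 1),
            abs_of_nonneg (h.gram.nonneg 2), h.scaledNorm_sq, h.scaledNorm_sq]
          ring
      _ ≤ K ^ 2 * scaledNorm τ N 2 ^ 2 := by
          gcongr; exacts [hX.nonneg 1, h.scaledNorm_one_le]
      _ ≤ K ^ 3 * (scaledNorm τ N 3 * scaledNorm τ N 2 + scaledNorm τ N 2 ^ 2 +
          √(τ * M) ^ 2) := by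
          gcongr
          · norm_num
          · nlinarith [sq_nonneg √(τ * M)]
  have hpow : τ ^ (k + 2) = √τ ^ (i + 1) * √τ ^ (j + 1) * √τ ^ m * √τ ^ (k + 1) := by
    rw [← pow_add, ← pow_add, ← pow_add, show i + 1 + (j + 1) + m + (k + 1) = 2 * (k + 2) by lia,
      pow_mul, Real.sq_sqrt hτ.le]
  calc τ ^ (k + 2) * (|N (i + 1) (j + 1)| * |N m (k + 1)|)
      ≤ τ ^ (k + 2) * (√(N (i + 1) (i + 1)) * √(N (j + 1) (j + 1)) *
          (√(N m m) * √(N (k + 1) (k + 1)))) := by gcongr <;> exact h.gram.abs_le _ _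
    _ = scaledNorm τ N (i + 1) * scaledNorm τ N (j + 1) * scaledNorm τ N m *
          scaledNorm τ N (k + 1) := by rw [hpow]; unfold scaledNorm; ring
    _ ≤ _ := hX.gram_mul_le (Nat.le_add_left 1 k) hw hne

theorem pow_mul_curv_le (h : IsEstimatePoint Λ τ M K N k) {i j m : ℕ}
    (hw : i + j + m + 1 = k + 1) :
    τ ^ (k + 2) * ReactionTerm.bound Λ N (k + 1) (.curv i j m) ≤
      K ^ 3 * (scaledNorm τ N (k + 2) * scaledNorm τ N (k + 1) + scaledNorm τ N (k + 1) ^ 2 +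
        √(τ * M) ^ 2) := by
  have hX := h.hasLowerOrderBounds
  have hpow : τ ^ (k + 2) = τ * (√τ ^ i * √τ ^ (j + 1) * √τ ^ m * √τ ^ (k + 1)) := by
    rw [← pow_add, ← pow_add, ← pow_add, show i + (j + 1) + m + (k + 1) = 2 * (k + 1) by lia,
      pow_mul, Real.sq_sqrt h.time_pos.le, ← pow_succ']
  have hnonneg : 0 ≤ scaledNorm τ N i * scaledNorm τ N (j + 1) * scaledNorm τ N m *
      scaledNorm τ N (k + 1) := by
    unfold scaledNorm
    positivity
  calc τ ^ (k + 2) * (Λ * (√(N i i) * √(N (j + 1) (j + 1)) * √(N m m) * √(N (k + 1) (k + 1))))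
      = τ * Λ * (scaledNorm τ N i * scaledNorm τ N (j + 1) * scaledNorm τ N m *
          scaledNorm τ N (k + 1)) := by rw [hpow]; unfold scaledNorm; ring
    _ ≤ scaledNorm τ N i * scaledNorm τ N (j + 1) * scaledNorm τ N m * scaledNorm τ N (k + 1) :=
      mul_le_of_le_one_left hnonneg (by linarith [h.time_mul_curvature_le])
    _ ≤ _ := hX.curv_mul_le hw

theorem pow_mul_reactionBound_le (h : IsEstimatePoint Λ τ M K N k) :
    τ ^ (k + 2) * reactionBound Λ N (k + 1) ≤ (reaction (k + 1)).length * K ^ 3 *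
      (scaledNorm τ N (k + 2) * scaledNorm τ N (k + 1) + scaledNorm τ N (k + 1) ^ 2 +
        √(τ * M) ^ 2) := by
  rw [reactionBound, ← List.sum_map_mul_left, mul_assoc, ← nsmul_eq_mul, ← List.length_map]
  refine List.sum_le_card_nsmul _ _ fun x hx ↦ ?_
  obtain ⟨q, hq, rfl⟩ := List.mem_map.1 hx
  have hw := weight_of_mem_reaction hq
  cases q with
  | gram i j m => exact h.pow_mul_gram_le hw
  | curv i j m => exact h.pow_mul_curv_le hw

theorem reaction_estimate (h : IsEstimatePoint Λ τ M K N k) {S : ℝ}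
    (hS : |S| ≤ reactionBound Λ N (k + 1)) :
    τ ^ (k + 1) * (-2 * N (k + 2) (k + 2) + 2 * S) ≤ -(τ ^ (k + 1) * N (k + 2) (k + 2)) +
      reactionConst (k + 1) K * (τ ^ k * N (k + 1) (k + 1) + M) := by
  have hτ := h.time_pos
  have hτS : τ ^ (k + 2) * S ≤ _ :=
    (mul_le_mul_of_nonneg_left ((le_abs_self S).trans hS) (by positivity)).trans
      h.pow_mul_reactionBound_le
  have hε : √(τ * M) ^ 2 = τ * M := Real.sq_sqrt (mul_nonneg hτ.le h.bound_nonneg)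
  unfold reactionConst
  set A : ℝ := (reaction (k + 1)).length * K ^ 3
  set X := scaledNorm τ N
  have habsorb : 2 * A * (X (k + 2) * X (k + 1)) ≤ X (k + 2) ^ 2 + A ^ 2 * X (k + 1) ^ 2 := by
    nlinarith [sq_nonneg (X (k + 2) - A * X (k + 1))]
  refine le_of_mul_le_mul_left ?_ hτ
  calc τ * (τ ^ (k + 1) * (-2 * N (k + 2) (k + 2) + 2 * S))
      = -2 * X (k + 2) ^ 2 + 2 * (τ ^ (k + 2) * S) := by rw [h.scaledNorm_sq]; ring
    _ ≤ -X (k + 2) ^ 2 + (A ^ 2 + 2 * A) * (X (k + 1) ^ 2 + √(τ * M) ^ 2) := by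
      nlinarith [mul_nonneg (sq_nonneg A) (sq_nonneg √(τ * M))]
    _ = τ * (-(τ ^ (k + 1) * N (k + 2) (k + 2)) +
          (A ^ 2 + 2 * A) * (τ ^ k * N (k + 1) (k + 1) + M)) := by
      rw [h.scaledNorm_sq, h.scaledNorm_sq, hε]; ring

end IsEstimatePoint

end ReactionEstimate

section ScalarFlow

/-- The properties of the inner products `G i j u t = ⟨A_i, A_j⟩` and of the speed `v` along a curve
shortening flow on the time interval `J` that lead to the derivative estimates. -/
structure IsScalarFlow (Λ : ℝ) (J : Set ℝ) (G : ℕ → ℕ → ℝ → ℝ → ℝ) (v : ℝ → ℝ → ℝ) : Prop where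
  continuousOn : ∀ l, ContinuousOn (fun x : ℝ × ℝ ↦ G l l x.1 x.2) (univ ×ˢ J)
  periodic : ∀ l, ∀ t ∈ J, Function.Periodic (fun u ↦ G l l u t) (2 * Real.pi)
  nonneg : ∀ l u t, 0 ≤ G l l u t
  gram : ∀ t ∈ interior J, ∀ u, IsTangentGram fun i j ↦ G i j u t
  speed_pos : ∀ t ∈ interior J, ∀ u, 0 < v u t
  differentiableAt_speed : ∀ t ∈ interior J, ∀ u, DifferentiableAt ℝ (fun u ↦ v u t) u
  hasDerivAt_fst : ∀ i j, ∀ t ∈ interior J, ∀ u,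
    HasDerivAt (fun u ↦ G i j u t) (v u t * (G (i + 1) j u t + G i (j + 1) u t)) u
  hasDerivAt_snd : ∀ l, ∀ t ∈ interior J, ∀ u, ∃ S,
    |S| ≤ reactionBound Λ (fun i j ↦ G i j u t) l ∧
    HasDerivAt (fun t ↦ G l l u t) (2 * G (l + 2) l u t + 2 * S) t

theorem IsScalarFlow.nonpos_of_spatial_max {Λ : ℝ} {J : Set ℝ} {G : ℕ → ℕ → ℝ → ℝ → ℝ}
    {v : ℝ → ℝ → ℝ} (h : IsScalarFlow Λ J G v) {t : ℝ} (ht : t ∈ interior J) {u α β : ℝ} (l m : ℕ)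
    (hmax : ∀ u', α * G l l u' t + β * G m m u' t ≤ α * G l l u t + β * G m m u t) :
    α * (G (l + 2) l u t + G (l + 1) (l + 1) u t) +
      β * (G (m + 2) m u t + G (m + 1) (m + 1) u t) ≤ 0 := by
  have hd := fun i j ↦ h.hasDerivAt_fst i j t ht
  have hfirst : ∀ x, HasDerivAt (fun x ↦ α * G l l x t + β * G m m x t)
      (v x t * (α * (G (l + 1) l x t + G l (l + 1) x t) +
        β * (G (m + 1) m x t + G m (m + 1) x t))) x := fun x ↦
    (((hd l l x).const_mul α).add ((hd m m x).const_mul β)).congr_deriv (by ring)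
  have hsecond := (h.differentiableAt_speed t ht u).hasDerivAt.fun_mul
    ((((hd (l + 1) l u).fun_add (hd l (l + 1) u)).const_mul α).fun_add
      (((hd (m + 1) m u).fun_add (hd m (m + 1) u)).const_mul β))
  obtain ⟨hcrit, hnonpos⟩ := deriv_eq_zero_and_deriv_nonpos_of_max hfirst hsecond hmax
  have hv := h.speed_pos t ht u
  have hsymm := (h.gram t ht u).symm
  rw [(mul_eq_zero.1 hcrit).resolve_left hv.ne', mul_zero, zero_add, hsymm l (l + 1 + 1),
    hsymm m (m + 1 + 1)] at hnonpos
  refine nonpos_of_mul_nonpos_right (a := 2 * v u t ^ 2) ?_ (by positivity)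
  linarith

/-- The solution of `y' = 2 y² + 2 Λ y` with value `K` at time `t₀`. -/
def barrier (Λ K t₀ t : ℝ) : ℝ :=
  K * Real.exp (2 * Λ * (t - t₀)) / (1 - K / Λ * (Real.exp (2 * Λ * (t - t₀)) - 1))

section Barrier

variable {Λ K t₀ t : ℝ}

theorem barrier_self (Λ K t₀ : ℝ) : barrier Λ K t₀ t₀ = K := by simp [barrier]

theorem exp_le_two_mul_one_sub (hΛ : 0 < Λ) (hK : 0 ≤ K)
    (ht : t ≤ t₀ + 1 / (2 * Λ) * Real.log (1 + Λ / (4 * K + Λ + 1))) :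
    Real.exp (2 * Λ * (t - t₀)) ≤ 2 * (1 - K / Λ * (Real.exp (2 * Λ * (t - t₀)) - 1)) := by
  have hD : 0 < 4 * K + Λ + 1 := by positivity
  have hexp : Real.exp (2 * Λ * (t - t₀)) ≤ 1 + Λ / (4 * K + Λ + 1) := by
    rw [← Real.le_log_iff_exp_le (by positivity)]
    calc 2 * Λ * (t - t₀) ≤ 2 * Λ * (1 / (2 * Λ) * Real.log (1 + Λ / (4 * K + Λ + 1))) := by
          gcongr; linarith
      _ = Real.log (1 + Λ / (4 * K + Λ + 1)) := by field_simp
  have hmul : K / Λ * (Real.exp (2 * Λ * (t - t₀)) - 1) ≤ K / (4 * K + Λ + 1) :=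
    calc K / Λ * (Real.exp (2 * Λ * (t - t₀)) - 1) ≤ K / Λ * (Λ / (4 * K + Λ + 1)) := by
          gcongr; linarith
      _ = K / (4 * K + Λ + 1) := by field_simp
  have hsum : Λ / (4 * K + Λ + 1) + 2 * (K / (4 * K + Λ + 1)) ≤ 1 := by
    rw [← mul_div_assoc, ← add_div, div_le_one hD]; linarith
  linarith

theorem hasDerivAt_barrier (hΛ : 0 < Λ) (hK : 0 ≤ K)
    (ht : t ≤ t₀ + 1 / (2 * Λ) * Real.log (1 + Λ / (4 * K + Λ + 1))) :
    HasDerivAt (barrier Λ K t₀) (2 * barrier Λ K t₀ t ^ 2 + 2 * Λ * barrier Λ K t₀ t) t := by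
  have hle := exp_le_two_mul_one_sub hΛ hK ht
  have hexp := hasDerivAt_exp_mul_sub (2 * Λ) t₀ t
  have hden : 0 < 1 - K / Λ * (Real.exp (2 * Λ * (t - t₀)) - 1) := by
    linarith [Real.exp_pos (2 * Λ * (t - t₀))]
  refine ((hexp.const_mul K).div (((hexp.sub_const 1).const_mul (K / Λ)).const_sub 1)
    hden.ne').congr_deriv ?_
  unfold barrier
  field_simp
  ring

theorem barrier_le_two_mul (hΛ : 0 < Λ) (hK : 0 ≤ K)
    (ht : t ≤ t₀ + 1 / (2 * Λ) * Real.log (1 + Λ / (4 * K + Λ + 1))) :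
    barrier Λ K t₀ t ≤ 2 * K := by
  have hle := exp_le_two_mul_one_sub hΛ hK ht
  rw [barrier, div_le_iff₀ (by linarith [Real.exp_pos (2 * Λ * (t - t₀))])]
  nlinarith

end Barrier

/-- A scalar flow, restricted to an interval `[t₀, t₁]` of the length for which the estimates hold,
with initial curvature bound `k² ≤ K₀`. -/
structure IsShortTimeFlow (Λ : ℝ) (J : Set ℝ) (G : ℕ → ℕ → ℝ → ℝ → ℝ) (v : ℝ → ℝ → ℝ)
    (t₀ t₁ K₀ : ℝ) : Prop where
  flow : IsScalarFlow Λ J G v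
  pos : 0 < Λ
  ordConnected : J.OrdConnected
  left_mem : t₀ ∈ J
  right_mem : t₁ ∈ J
  initial : ∀ u, G 1 1 u t₀ ≤ K₀
  time_le : t₁ ≤ t₀ + 1 / (2 * Λ) * Real.log (1 + Λ / (4 * K₀ + Λ + 1))

namespace IsShortTimeFlow

variable {Λ : ℝ} {J : Set ℝ} {G : ℕ → ℕ → ℝ → ℝ → ℝ} {v : ℝ → ℝ → ℝ} {t₀ t₁ K₀ t : ℝ}

theorem bound_nonneg (h : IsShortTimeFlow Λ J G v t₀ t₁ K₀) : 0 ≤ K₀ :=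
  (h.flow.nonneg 1 0 t₀).trans (h.initial 0)

theorem Icc_subset (h : IsShortTimeFlow Λ J G v t₀ t₁ K₀) : Icc t₀ t₁ ⊆ J :=
  h.ordConnected.out h.left_mem h.right_mem

theorem Ioo_subset (h : IsShortTimeFlow Λ J G v t₀ t₁ K₀) : Ioo t₀ t₁ ⊆ interior J :=
  interior_maximal (Ioo_subset_Icc_self.trans h.Icc_subset) isOpen_Ioo

theorem continuousOn (h : IsShortTimeFlow Λ J G v t₀ t₁ K₀) (l : ℕ) :
    ContinuousOn (fun x : ℝ × ℝ ↦ G l l x.1 x.2) (univ ×ˢ Icc t₀ t₁) :=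
  (h.flow.continuousOn l).mono (prod_mono subset_rfl h.Icc_subset)

theorem periodic (h : IsShortTimeFlow Λ J G v t₀ t₁ K₀) (l : ℕ) (ht : t ∈ Icc t₀ t₁) (u : ℝ) :
    G l l (u + 2 * Real.pi) t = G l l u t :=
  h.flow.periodic l t (h.Icc_subset ht) u

theorem time_le_of_mem (h : IsShortTimeFlow Λ J G v t₀ t₁ K₀) (ht : t ∈ Icc t₀ t₁) :
    t ≤ t₀ + 1 / (2 * Λ) * Real.log (1 + Λ / (4 * K₀ + Λ + 1)) :=
  ht.2.trans h.time_le

theorem time_mul_le (h : IsShortTimeFlow Λ J G v t₀ t₁ K₀) (ht : t ∈ Icc t₀ t₁) :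
    (t - t₀) * (4 * K₀ + Λ + 1) ≤ 1 / 2 := by
  have hΛ := h.pos
  have hK := h.bound_nonneg
  have hlog : Real.log (1 + Λ / (4 * K₀ + Λ + 1)) ≤ Λ / (4 * K₀ + Λ + 1) := by
    linarith [Real.log_le_sub_one_of_pos (x := 1 + Λ / (4 * K₀ + Λ + 1)) (by positivity)]
  rw [← le_div_iff₀ (by positivity)]
  calc t - t₀ ≤ 1 / (2 * Λ) * Real.log (1 + Λ / (4 * K₀ + Λ + 1)) := by
        linarith [h.time_le_of_mem ht]
    _ ≤ 1 / (2 * Λ) * (Λ / (4 * K₀ + Λ + 1)) := by gcongr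
    _ = 1 / 2 / (4 * K₀ + Λ + 1) := by field_simp

theorem exists_curvature_bound (h : IsShortTimeFlow Λ J G v t₀ t₁ K₀) (ht : t₀ ≤ t₁) :
    ∃ C, ∀ t ∈ Icc t₀ t₁, ∀ u, G 1 1 u t ≤ C := by
  obtain ⟨x, -, hx⟩ := exists_isMaxOn_of_periodic Real.two_pi_pos ht
    (fun _ ↦ h.periodic 1) (h.continuousOn 1)
  exact ⟨G 1 1 x.1 x.2, fun t ht u ↦ hx (show (u, t) ∈ univ ×ˢ Icc t₀ t₁ from ⟨mem_univ u, ht⟩)⟩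

theorem exists_hasDerivAt_curvature_le (h : IsShortTimeFlow Λ J G v t₀ t₁ K₀)
    (ht : t ∈ Ioo t₀ t₁) {u : ℝ} (hmax : ∀ u', G 1 1 u' t ≤ G 1 1 u t) :
    ∃ d, HasDerivAt (G 1 1 u) d t ∧ d ≤ 2 * G 1 1 u t ^ 2 + 2 * Λ * G 1 1 u t := by
  have htJ := h.Ioo_subset ht
  have hgram := h.flow.gram t htJ u
  obtain ⟨S, hS, hd⟩ := h.flow.hasDerivAt_snd 1 t htJ u
  rw [hgram.reactionBound_one] at hS
  have hspatial := h.flow.nonpos_of_spatial_max htJ (α := 1) (β := 0) (u := u) 1 0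
    fun u' ↦ by linarith [hmax u']
  exact ⟨_, hd, by linarith [hgram.sq_le, le_of_abs_le hS]⟩

theorem curvature_le_barrier (h : IsShortTimeFlow Λ J G v t₀ t₁ K₀) (ht : t ∈ Icc t₀ t₁) (u : ℝ) :
    G 1 1 u t ≤ barrier Λ K₀ t₀ t := by
  have hΛ := h.pos
  have hy := fun s (hs : s ∈ Icc t₀ t₁) ↦
    hasDerivAt_barrier hΛ h.bound_nonneg (h.time_le_of_mem hs)
  obtain ⟨C, hC⟩ := h.exists_curvature_bound (ht.1.trans ht.2)
  refine sub_nonpos.1 (nonpos_of_deriv_le_of_max (w := fun u s ↦ G 1 1 u s - barrier Λ K₀ t₀ s)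
    (C := 2 * (C + 2 * K₀) + 2 * Λ) Real.two_pi_pos ?_ ?_ ?_ ?_ ht u)
  · exact fun s hs u ↦ by simp only [h.periodic 1 hs]
  · have hcont : ContinuousOn (barrier Λ K₀ t₀) (Icc t₀ t₁) := fun s hs ↦
      (hy s hs).continuousAt.continuousWithinAt
    exact (h.continuousOn 1).sub (hcont.comp continuousOn_snd fun x hx ↦ hx.2)
  · exact fun u ↦ by simpa only [barrier_self, sub_nonpos] using h.initial u
  · intro s hs u hpos hmax
    have hsI := Ioo_subset_Icc_self hs
    obtain ⟨d, hd, hdle⟩ := h.exists_hasDerivAt_curvature_le hs (u := u)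
      fun u' ↦ by linarith [hmax u']
    refine ⟨_, hd.sub (hy s hsI), ?_⟩
    have hfactor : 2 * (G 1 1 u s + barrier Λ K₀ t₀ s) + 2 * Λ ≤ 2 * (C + 2 * K₀) + 2 * Λ := by
      linarith [hC s hsI u, barrier_le_two_mul hΛ h.bound_nonneg (h.time_le_of_mem hsI)]
    linarith [mul_le_mul_of_nonneg_right hfactor hpos.le]

theorem curvature_le (h : IsShortTimeFlow Λ J G v t₀ t₁ K₀) (ht : t ∈ Icc t₀ t₁) (u : ℝ) :
    G 1 1 u t ≤ 2 * K₀ :=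
  (h.curvature_le_barrier ht u).trans
    (barrier_le_two_mul h.pos h.bound_nonneg (h.time_le_of_mem ht))

theorem isEstimatePoint (h : IsShortTimeFlow Λ J G v t₀ t₁ K₀) (ht : t ∈ Ioo t₀ t₁) {u K : ℝ}
    (hK : 1 ≤ K) {k : ℕ} (hlower : ∀ j < k, (t - t₀) ^ j * G (j + 1) (j + 1) u t ≤ K * K₀) :
    IsEstimatePoint Λ (t - t₀) K₀ K (fun i j ↦ G i j u t) k where
  gram := h.flow.gram t (h.Ioo_subset ht) u
  curvature_nonneg := h.pos.le
  time_pos := sub_pos.2 ht.1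
  one_le := hK
  time_mul_le := by
    nlinarith [h.time_mul_le (Ioo_subset_Icc_self ht), mul_pos (sub_pos.2 ht.1) h.pos, ht.1]
  time_mul_curvature_le := by
    nlinarith [h.time_mul_le (Ioo_subset_Icc_self ht),
      mul_nonneg (sub_nonneg.2 ht.1.le) h.bound_nonneg, ht.1]
  le_two_mul := h.curvature_le (Ioo_subset_Icc_self ht) u
  lower := hlower

end IsShortTimeFlow

/-- The coefficient `B` of the lower order term in the test function
`τ^{n+2} |A_{n+2}|² + B τ^{n+1} |A_{n+1}|²`, large enough for its good term to absorb the bad ones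
of the leading term. -/
def testCoeff (n : ℕ) (K : ℝ) : ℝ := reactionConst (n + 2) K + (n + 2)

/-- The slope of a linear upper barrier for the test function with coefficient `testCoeff n K`. -/
def testSlope (n : ℕ) (K : ℝ) : ℝ :=
  reactionConst (n + 2) K + testCoeff n K * ((n + 1) * K + reactionConst (n + 1) K * (K + 1))

/-- The constants in the derivative estimates: `derivConst n` is the one for
`A_{n+1} = D^{n+1} T/∂s^{n+1}`. -/
def derivConst : ℕ → ℝ
  | 0 => 2
  | n + 1 => max (derivConst n) (testSlope n (derivConst n))

theorem one_le_derivConst (n : ℕ) : 1 ≤ derivConst n := by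
  induction n with
  | zero => exact one_le_two
  | succ n ih => exact le_max_of_le_left ih

theorem testCoeff_nonneg (n : ℕ) {K : ℝ} (hK : 0 ≤ K) : 0 ≤ testCoeff n K :=
  add_nonneg (reactionConst_nonneg _ hK) (by positivity)

theorem IsEstimatePoint.deriv_test_le {Λ τ M K : ℝ} {N : ℕ → ℕ → ℝ} {n : ℕ}
    (h : IsEstimatePoint Λ τ M K N (n + 1)) {S₀ S₁ : ℝ}
    (hS₁ : |S₁| ≤ reactionBound Λ N (n + 2)) (hS₀ : |S₀| ≤ reactionBound Λ N (n + 1))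
    (hmax : τ ^ (n + 2) * (N (n + 4) (n + 2) + N (n + 3) (n + 3)) +
      testCoeff n K * τ ^ (n + 1) * (N (n + 3) (n + 1) + N (n + 2) (n + 2)) ≤ 0) :
    (n + 2) * τ ^ (n + 1) * N (n + 2) (n + 2) +
        τ ^ (n + 2) * (2 * N (n + 4) (n + 2) + 2 * S₁) +
      (testCoeff n K * ((n + 1) * τ ^ n) * N (n + 1) (n + 1) +
        testCoeff n K * τ ^ (n + 1) * (2 * N (n + 3) (n + 1) + 2 * S₀)) ≤ testSlope n K * M := by
  have hK : 0 ≤ K := zero_le_one.trans h.one_le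
  have hB := testCoeff_nonneg n hK
  have hpoint : IsEstimatePoint Λ τ M K N n :=
    { h with lower := fun j hj ↦ h.lower j (Nat.lt_succ_of_lt hj) }
  have hlead := h.reaction_estimate hS₁
  have hlow := mul_le_mul_of_nonneg_left (hpoint.reaction_estimate hS₀) hB
  have hlower := mul_le_mul_of_nonneg_left (h.lower n (Nat.lt_succ_self n))
    (mul_nonneg hB (add_nonneg (by positivity : (0 : ℝ) ≤ n + 1) (reactionConst_nonneg (n + 1) hK)))
  have hgood : 0 ≤ τ ^ (n + 2) * N (n + 3) (n + 3) :=
    mul_nonneg (pow_nonneg h.time_pos.le _) (h.gram.nonneg _)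
  have hcoeff : reactionConst (n + 2) K = testCoeff n K - (n + 2) := by
    rw [testCoeff, add_sub_cancel_right]
  rw [hcoeff] at hlead
  rw [testSlope, hcoeff]
  linarith

namespace IsShortTimeFlow

variable {Λ : ℝ} {J : Set ℝ} {G : ℕ → ℕ → ℝ → ℝ → ℝ} {v : ℝ → ℝ → ℝ} {t₀ t₁ K₀ t K : ℝ} {n : ℕ}

theorem exists_hasDerivAt_test_le (h : IsShortTimeFlow Λ J G v t₀ t₁ K₀) (ht : t ∈ Ioo t₀ t₁)
    {u : ℝ} (hK : 1 ≤ K)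
    (hlower : ∀ j < n + 1, (t - t₀) ^ j * G (j + 1) (j + 1) u t ≤ K * K₀)
    (hmax : ∀ u', (t - t₀) ^ (n + 2) * G (n + 2) (n + 2) u' t +
        testCoeff n K * (t - t₀) ^ (n + 1) * G (n + 1) (n + 1) u' t ≤
      (t - t₀) ^ (n + 2) * G (n + 2) (n + 2) u t +
        testCoeff n K * (t - t₀) ^ (n + 1) * G (n + 1) (n + 1) u t) :
    ∃ d, HasDerivAt (fun s ↦ (s - t₀) ^ (n + 2) * G (n + 2) (n + 2) u s +
        testCoeff n K * (s - t₀) ^ (n + 1) * G (n + 1) (n + 1) u s) d t ∧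
      d ≤ testSlope n K * K₀ := by
  have htJ := h.Ioo_subset ht
  obtain ⟨S₁, hS₁, hd₁⟩ := h.flow.hasDerivAt_snd (n + 2) t htJ u
  obtain ⟨S₀, hS₀, hd₀⟩ := h.flow.hasDerivAt_snd (n + 1) t htJ u
  have hpow : ∀ m : ℕ, HasDerivAt (fun s ↦ (s - t₀) ^ (m + 1)) ((m + 1) * (t - t₀) ^ m) t :=
    fun m ↦ by simpa using ((hasDerivAt_id' t).sub_const t₀).fun_pow (m + 1)
  refine ⟨_, ((hpow (n + 1)).fun_mul hd₁).fun_add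
    (((hpow n).const_mul (testCoeff n K)).fun_mul hd₀), ?_⟩
  have hle := (h.isEstimatePoint ht hK hlower).deriv_test_le hS₁ hS₀
    (h.flow.nonpos_of_spatial_max htJ (n + 2) (n + 1) hmax)
  push_cast
  linarith

theorem test_le (h : IsShortTimeFlow Λ J G v t₀ t₁ K₀) (hK : 1 ≤ K)
    (hlower : ∀ t ∈ Ioo t₀ t₁, ∀ u, ∀ j < n + 1,
      (t - t₀) ^ j * G (j + 1) (j + 1) u t ≤ K * K₀) (ht : t ∈ Icc t₀ t₁) (u : ℝ) :
    (t - t₀) ^ (n + 2) * G (n + 2) (n + 2) u t +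
      testCoeff n K * (t - t₀) ^ (n + 1) * G (n + 1) (n + 1) u t ≤
        testSlope n K * K₀ * (t - t₀) := by
  refine sub_nonpos.1 (nonpos_of_deriv_le_of_max (C := 0)
    (w := fun u s ↦ (s - t₀) ^ (n + 2) * G (n + 2) (n + 2) u s +
      testCoeff n K * (s - t₀) ^ (n + 1) * G (n + 1) (n + 1) u s -
        testSlope n K * K₀ * (s - t₀)) Real.two_pi_pos ?_ ?_ ?_ ?_ ht u)
  · exact fun s hs u ↦ by simp only [h.periodic _ hs]
  · have hcont := h.continuousOn
    fun_prop
  · simp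
  · rintro s hs u - hmax
    obtain ⟨d, hd, hle⟩ := h.exists_hasDerivAt_test_le hs hK (hlower s hs u)
      fun u' ↦ by linarith [hmax u']
    have hlin := ((hasDerivAt_id' s).sub_const t₀).const_mul (testSlope n K * K₀)
    exact ⟨_, hd.sub hlin, by linarith⟩

theorem deriv_bound (h : IsShortTimeFlow Λ J G v t₀ t₁ K₀) (n : ℕ) :
    ∀ t ∈ Ioc t₀ t₁, ∀ u, ∀ j < n + 1,
      (t - t₀) ^ j * G (j + 1) (j + 1) u t ≤ derivConst n * K₀ := by
  have hK₀ := h.bound_nonneg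
  induction n with
  | zero =>
    intro t ht u j hj
    obtain rfl : j = 0 := Nat.lt_one_iff.1 hj
    simpa only [pow_zero, one_mul, zero_add] using! h.curvature_le (Ioc_subset_Icc_self ht) u
  | succ n ih =>
    intro t ht u j hj
    rcases (Nat.lt_succ_iff.1 hj).lt_or_eq with hj | rfl
    · exact (ih t ht u j hj).trans (mul_le_mul_of_nonneg_right (le_max_left _ _) hK₀)
    have hK := one_le_derivConst n
    have hτ : 0 < t - t₀ := sub_pos.2 ht.1
    have htest := h.test_le hK (fun s hs ↦ ih s (Ioo_subset_Ioc_self hs))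
      (Ioc_subset_Icc_self ht) u
    have hnonneg : 0 ≤ testCoeff n (derivConst n) * (t - t₀) ^ (n + 1) * G (n + 1) (n + 1) u t :=
      mul_nonneg (mul_nonneg (testCoeff_nonneg n (zero_le_one.trans hK)) (pow_nonneg hτ.le _))
        (h.flow.nonneg _ u t)
    refine le_trans (le_of_mul_le_mul_left ?_ hτ)
      (mul_le_mul_of_nonneg_right (le_max_right _ (testSlope n (derivConst n))) hK₀)
    calc (t - t₀) * ((t - t₀) ^ (n + 1) * G (n + 2) (n + 2) u t)
        = (t - t₀) ^ (n + 2) * G (n + 2) (n + 2) u t := by ring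
      _ ≤ (t - t₀) * (testSlope n (derivConst n) * K₀) := by linarith

end IsShortTimeFlow

end ScalarFlow

-- for the normed structures on iterated spaces of continuous linear maps
set_option maxSynthPendingDepth 3

section MetricField

variable {E : Type*} [NormedAddCommGroup E] [NormedSpace ℝ E]
  {F : Type*} [NormedAddCommGroup F] [NormedSpace ℝ F]

theorem hasFDerivAt_fderiv {f : E → F} {x : E} (hf : ContDiffAt ℝ 2 f x) :
    HasFDerivAt (fderiv ℝ f) (fderiv ℝ (fderiv ℝ f) x) x :=
  ((hf.fderiv_right (m := 1) (by norm_cast)).differentiableAt (by simp)).hasFDerivAt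

theorem fderiv_fderiv_comm {f : E → F} {x : E} (hf : ContDiffAt ℝ 2 f x) (a b : E) :
    fderiv ℝ (fderiv ℝ f) x a b = fderiv ℝ (fderiv ℝ f) x b a :=
  hf.isSymmSndFDerivAt (by simp) a b

/-- The Christoffel symbols of the first kind of a field `g` of bilinear forms, as a trilinear
map: `(v, w, z) ↦ ½ (∂_v g(w, z) + ∂_w g(v, z) - ∂_z g(v, w))`. -/
def christoffelLowerMap (g : E → E →L[ℝ] E →L[ℝ] ℝ) (y : E) : E →L[ℝ] E →L[ℝ] E →L[ℝ] ℝ :=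
  (1 / 2 : ℝ) • (fderiv ℝ g y + (fderiv ℝ g y).flip -
    ((ContinuousLinearMap.flipₗᵢ ℝ E E ℝ).toContinuousLinearEquiv.toContinuousLinearMap ∘L
      (fderiv ℝ g y).flip))

/-- The Christoffel symbols of a field `g` of bilinear forms, as a bilinear map. As in
`christoffel`, the index is raised with `(g y).inverse`, which is `0` if `g y` is degenerate. -/
def christoffelMap (g : E → E →L[ℝ] E →L[ℝ] ℝ) (y : E) : E →L[ℝ] E →L[ℝ] E :=
  ContinuousLinearMap.compL ℝ E (E →L[ℝ] ℝ) E (g y).inverse ∘L christoffelLowerMap g y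

/-- The curvature operator of a field `g` of bilinear forms, as a trilinear map, with the sign
convention of `curvature`. -/
def curvatureMap (g : E → E →L[ℝ] E →L[ℝ] ℝ) (y : E) : E →L[ℝ] E →L[ℝ] E →L[ℝ] E :=
  (fderiv ℝ (christoffelMap g) y).flip - fderiv ℝ (christoffelMap g) y
    + ((ContinuousLinearMap.compL ℝ E E E).bilinearComp (christoffelMap g y)
        (christoffelMap g y)).flip
    - (ContinuousLinearMap.compL ℝ E E E).bilinearComp (christoffelMap g y) (christoffelMap g y)

theorem christoffelLowerMap_apply (g : E → E →L[ℝ] E →L[ℝ] ℝ) (y v w z : E) :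
    christoffelLowerMap g y v w z =
      1 / 2 * (fderiv ℝ g y v w z + fderiv ℝ g y w v z - fderiv ℝ g y z v w) := by
  simp [christoffelLowerMap]

theorem christoffelMap_apply (g : E → E →L[ℝ] E →L[ℝ] ℝ) (y v w : E) :
    christoffelMap g y v w = (g y).inverse (christoffelLowerMap g y v w) :=
  rfl

theorem curvatureMap_apply (g : E → E →L[ℝ] E →L[ℝ] ℝ) (y v w z : E) :
    curvatureMap g y v w z =
      fderiv ℝ (christoffelMap g) y w v z - fderiv ℝ (christoffelMap g) y v w z
        + christoffelMap g y w (christoffelMap g y v z)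
        - christoffelMap g y v (christoffelMap g y w z) := by
  simp [curvatureMap]

/-- The curvature of `g` is parallel on `Ω`, i.e. `∇ R = 0` there. -/
def HasParallelCurvatureOn (g : E → E →L[ℝ] E →L[ℝ] ℝ) (Ω : Set E) : Prop :=
  ∀ y ∈ Ω, ∀ a v w z,
    fderiv ℝ (curvatureMap g) y a v w z + christoffelMap g y a (curvatureMap g y v w z) =
      curvatureMap g y (christoffelMap g y a v) w z
        + curvatureMap g y v (christoffelMap g y a w) z
        + curvatureMap g y v w (christoffelMap g y a z)

/-- `g` is a smooth Riemannian metric on the open set `Ω` of a vector space. -/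
structure IsMetricOn (g : E → E →L[ℝ] E →L[ℝ] ℝ) (Ω : Set E) : Prop where
  isOpen : IsOpen Ω
  contDiffOn : ContDiffOn ℝ ∞ g Ω
  symm : ∀ y ∈ Ω, ∀ v w, g y v w = g y w v
  pos : ∀ y ∈ Ω, ∀ v, v ≠ 0 → 0 < g y v v

namespace IsMetricOn

variable {g : E → E →L[ℝ] E →L[ℝ] ℝ} {Ω : Set E} {y : E}

theorem eq_of_forall (hg : IsMetricOn g Ω) (hy : y ∈ Ω) {v w : E} (h : ∀ z, g y v z = g y w z) :
    v = w := by
  by_contra hne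
  have hpos := hg.pos y hy (v - w) (sub_ne_zero.2 hne)
  simp [h] at hpos

theorem differentiableAt (hg : IsMetricOn g Ω) (hy : y ∈ Ω) : DifferentiableAt ℝ g y :=
  (hg.contDiffOn.contDiffAt (hg.isOpen.mem_nhds hy)).differentiableAt (by simp)

theorem fderiv_symm (hg : IsMetricOn g Ω) (hy : y ∈ Ω) (a v w : E) :
    fderiv ℝ g y a v w = fderiv ℝ g y a w v := by
  have hd : ∀ v w, HasFDerivAt (fun y ↦ g y v w) _ y := fun v w ↦
    ((hg.differentiableAt hy).hasFDerivAt.clm_apply (hasFDerivAt_const v y)).clm_apply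
      (hasFDerivAt_const w y)
  have heq : (fun y ↦ g y v w) =ᶠ[nhds y] fun y ↦ g y w v := by
    filter_upwards [hg.isOpen.mem_nhds hy] with y hy using hg.symm y hy v w
  simpa using congr($((hd v w).unique ((hd w v).congr_of_eventuallyEq heq)) a)

variable {g' : E → E →L[ℝ] E →L[ℝ] ℝ} {Ω' : Set E} {θ : E → E}

theorem fderiv_apply_of_pullback (hg : IsMetricOn g Ω) (hg' : IsMetricOn g' Ω') (hy : y ∈ Ω)
    (hθy : θ y ∈ Ω') (hθ : ContDiffAt ℝ 2 θ y)
    (h : ∀ᶠ z in nhds y, ∀ v w, g z v w = g' (θ z) (fderiv ℝ θ z v) (fderiv ℝ θ z w))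
    (a b c : E) :
    fderiv ℝ g y a b c =
      fderiv ℝ g' (θ y) (fderiv ℝ θ y a) (fderiv ℝ θ y b) (fderiv ℝ θ y c)
        + g' (θ y) (fderiv ℝ (fderiv ℝ θ) y a b) (fderiv ℝ θ y c)
        + g' (θ y) (fderiv ℝ θ y b) (fderiv ℝ (fderiv ℝ θ) y a c) := by
  have hθ' := (hθ.differentiableAt (by simp)).hasFDerivAt
  have hleft : HasFDerivAt (fun y ↦ g y b c) _ y :=
    ((hg.differentiableAt hy).hasFDerivAt.clm_apply (hasFDerivAt_const b y)).clm_apply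
      (hasFDerivAt_const c y)
  have hright : HasFDerivAt (fun z ↦ g' (θ z) (fderiv ℝ θ z b) (fderiv ℝ θ z c)) _ y :=
    (((hg'.differentiableAt hθy).hasFDerivAt.comp y hθ').clm_apply
      ((hasFDerivAt_fderiv hθ).clm_apply (hasFDerivAt_const b y))).clm_apply
      ((hasFDerivAt_fderiv hθ).clm_apply (hasFDerivAt_const c y))
  have heq := congr($(hleft.unique (hright.congr_of_eventuallyEq (h.mono fun z hz ↦ hz b c))) a)
  simp only [ContinuousLinearMap.comp_zero, zero_add, ContinuousLinearMap.flip_apply,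
    Function.comp_apply, ContinuousLinearMap.flip_add, add_apply,
    ContinuousLinearMap.comp_apply] at heq
  rw [heq]
  ring

variable [FiniteDimensional ℝ E]

theorem isInvertible (hg : IsMetricOn g Ω) (hy : y ∈ Ω) : (g y).IsInvertible := by
  have hinj : Function.Injective (g y) := fun v w h ↦ hg.eq_of_forall hy fun z ↦ by rw [h]
  have hdim : Module.finrank ℝ E = Module.finrank ℝ (E →L[ℝ] ℝ) := by
    rw [← LinearMap.toContinuousLinearMap.finrank_eq]
    exact (Subspace.dual_finrank_eq (K := ℝ) (V := E)).symm
  exact ⟨(LinearEquiv.ofInjectiveOfFinrankEq (g y).toLinearMap hinj hdim).toContinuousLinearEquiv,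
    by ext v w; rfl⟩

theorem apply_christoffelMap (hg : IsMetricOn g Ω) (hy : y ∈ Ω) (v w z : E) :
    g y (christoffelMap g y v w) z =
      1 / 2 * (fderiv ℝ g y v w z + fderiv ℝ g y w v z - fderiv ℝ g y z v w) := by
  have h : g y (christoffelMap g y v w) = christoffelLowerMap g y v w := by
    obtain ⟨e, he⟩ := hg.isInvertible hy
    rw [christoffelMap_apply, ← he]
    simp
  rw [h, christoffelLowerMap_apply]

theorem christoffelMap_comm (hg : IsMetricOn g Ω) (hy : y ∈ Ω) (v w : E) :
    christoffelMap g y v w = christoffelMap g y w v := by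
  refine hg.eq_of_forall hy fun z ↦ ?_
  rw [hg.apply_christoffelMap hy, hg.apply_christoffelMap hy, hg.fderiv_symm hy z v w]
  ring

theorem fderiv_apply (hg : IsMetricOn g Ω) (hy : y ∈ Ω) (a v w : E) :
    fderiv ℝ g y a v w = g y (christoffelMap g y a v) w + g y v (christoffelMap g y a w) := by
  rw [hg.symm y hy v, hg.apply_christoffelMap hy, hg.apply_christoffelMap hy,
    hg.fderiv_symm hy v a w, hg.fderiv_symm hy w a v, hg.fderiv_symm hy a v w]
  ring

theorem contDiffOn_christoffelMap (hg : IsMetricOn g Ω) :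
    ContDiffOn ℝ ∞ (christoffelMap g) Ω := by
  refine contDiffOn_clm_apply.2 fun v ↦ contDiffOn_clm_apply.2 fun w ↦ ?_
  have hinv : ContDiffOn ℝ ∞ (fun y ↦ (g y).inverse) Ω := fun y hy ↦
    (hg.isInvertible hy).contDiffAt_map_inverse.comp_contDiffWithinAt y (hg.contDiffOn y hy)
  have hfderiv : ∀ a b c : E, ContDiffOn ℝ ∞ (fun y ↦ fderiv ℝ g y a b c) Ω := fun a b c ↦
    (((hg.contDiffOn.fderiv_of_isOpen hg.isOpen (by simp)).clm_apply contDiffOn_const).clm_apply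
      contDiffOn_const).clm_apply contDiffOn_const
  simp only [christoffelMap_apply]
  refine hinv.clm_apply (contDiffOn_clm_apply.2 fun z ↦ ?_)
  simp only [christoffelLowerMap_apply]
  exact contDiffOn_const.mul (((hfderiv v w z).add (hfderiv w v z)).sub (hfderiv z v w))

theorem differentiableAt_christoffelMap (hg : IsMetricOn g Ω) (hy : y ∈ Ω) :
    DifferentiableAt ℝ (christoffelMap g) y :=
  (hg.contDiffOn_christoffelMap.contDiffAt (hg.isOpen.mem_nhds hy)).differentiableAt (by simp)

theorem contDiffOn_curvatureMap (hg : IsMetricOn g Ω) : ContDiffOn ℝ ∞ (curvatureMap g) Ω := by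
  refine contDiffOn_clm_apply.2 fun v ↦ contDiffOn_clm_apply.2 fun w ↦
    contDiffOn_clm_apply.2 fun z ↦ ?_
  have hΓ := hg.contDiffOn_christoffelMap
  have hfderiv : ∀ a b c : E, ContDiffOn ℝ ∞ (fun y ↦ fderiv ℝ (christoffelMap g) y a b c) Ω :=
    fun a b c ↦ (((hΓ.fderiv_of_isOpen hg.isOpen (by simp)).clm_apply
      contDiffOn_const).clm_apply contDiffOn_const).clm_apply contDiffOn_const
  have hsq : ∀ a b c : E,
      ContDiffOn ℝ ∞ (fun y ↦ christoffelMap g y a (christoffelMap g y b c)) Ω := fun a b c ↦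
    (hΓ.clm_apply contDiffOn_const).clm_apply
      ((hΓ.clm_apply contDiffOn_const).clm_apply contDiffOn_const)
  simp only [curvatureMap_apply]
  exact (((hfderiv w v z).sub (hfderiv v w z)).add (hsq w v z)).sub (hsq v w z)

theorem differentiableAt_curvatureMap (hg : IsMetricOn g Ω) (hy : y ∈ Ω) :
    DifferentiableAt ℝ (curvatureMap g) y :=
  (hg.contDiffOn_curvatureMap.contDiffAt (hg.isOpen.mem_nhds hy)).differentiableAt (by simp)

theorem fderiv_christoffelMap_of_pullback (hg : IsMetricOn g Ω) (hg' : IsMetricOn g' Ω')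
    (hy : y ∈ Ω) (hθy : θ y ∈ Ω') (hθ : ContDiffAt ℝ 2 θ y)
    (hsurj : Function.Surjective (fderiv ℝ θ y))
    (h : ∀ᶠ z in nhds y, ∀ v w, g z v w = g' (θ z) (fderiv ℝ θ z v) (fderiv ℝ θ z w))
    (v w : E) :
    fderiv ℝ θ y (christoffelMap g y v w) =
      fderiv ℝ (fderiv ℝ θ) y v w +
        christoffelMap g' (θ y) (fderiv ℝ θ y v) (fderiv ℝ θ y w) := by
  have hfderiv := hg.fderiv_apply_of_pullback hg' hy hθy hθ h
  have hsymm := fderiv_fderiv_comm hθ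
  refine hg'.eq_of_forall hθy fun z' ↦ ?_
  obtain ⟨z, rfl⟩ := hsurj z'
  rw [← h.self_of_nhds, hg.apply_christoffelMap hy, map_add, add_apply,
    hg'.apply_christoffelMap hθy, hfderiv, hfderiv, hfderiv, hsymm w v, hsymm z v, hsymm z w,
    hg'.symm _ hθy (fderiv ℝ θ y v) (fderiv ℝ (fderiv ℝ θ) y w z),
    hg'.symm _ hθy (fderiv ℝ θ y w) (fderiv ℝ (fderiv ℝ θ) y v z)]
  ring_nf

end IsMetricOn

end MetricField

section AlongMaps

variable {E : Type*} [NormedAddCommGroup E] [NormedSpace ℝ E]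
  {P : Type*} [NormedAddCommGroup P] [NormedSpace ℝ P]

/-- The covariant derivative, in direction `e`, of a vector field `V` along a map `c`. -/
def covD (g : E → E →L[ℝ] E →L[ℝ] ℝ) (c : P → E) (e : P) (V : P → E) (p : P) : E :=
  fderiv ℝ V p e + christoffelMap g (c p) (fderiv ℝ c p e) (V p)

variable {g : E → E →L[ℝ] E →L[ℝ] ℝ} {Ω : Set E} {c : P → E} {V W : P → E} {p : P}

theorem covD_congr {U : Set P} (hU : IsOpen U) (hp : p ∈ U) (h : EqOn V W U) (e : P) :
    covD g c e V p = covD g c e W p := by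
  rw [covD, covD, (Filter.eventuallyEq_of_mem (hU.mem_nhds hp) h).fderiv_eq, h hp]

theorem covD_add (hV : DifferentiableAt ℝ V p) (hW : DifferentiableAt ℝ W p) (e : P) :
    covD g c e (fun q ↦ V q + W q) p = covD g c e V p + covD g c e W p := by
  simp only [covD, fderiv_fun_add hV hW, map_add, add_apply]
  abel

theorem covD_smul {f : P → ℝ} (hf : DifferentiableAt ℝ f p) (hV : DifferentiableAt ℝ V p)
    (e : P) :
    covD g c e (fun q ↦ f q • V q) p = fderiv ℝ f p e • V p + f p • covD g c e V p := by
  simp only [covD, fderiv_fun_smul hf hV, map_smul, add_apply, smul_apply,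
    ContinuousLinearMap.smulRight_apply, smul_add]
  abel

namespace IsMetricOn

theorem differentiableAt_comp (hg : IsMetricOn g Ω) (hp : c p ∈ Ω) (hc : DifferentiableAt ℝ c p)
    (hV : DifferentiableAt ℝ V p) (hW : DifferentiableAt ℝ W p) :
    DifferentiableAt ℝ (fun q ↦ g (c q) (V q) (W q)) p :=
  (((hg.differentiableAt hp).comp p hc).clm_apply hV).clm_apply hW

variable [FiniteDimensional ℝ E]

theorem fderiv_comp (hg : IsMetricOn g Ω) (hp : c p ∈ Ω) (hc : DifferentiableAt ℝ c p)
    (hV : DifferentiableAt ℝ V p) (hW : DifferentiableAt ℝ W p) (e : P) :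
    fderiv ℝ (fun q ↦ g (c q) (V q) (W q)) p e =
      g (c p) (covD g c e V p) (W p) + g (c p) (V p) (covD g c e W p) := by
  have h : HasFDerivAt (fun q ↦ g (c q) (V q) (W q)) _ p :=
    (((hg.differentiableAt hp).hasFDerivAt.comp p hc.hasFDerivAt).clm_apply
      hV.hasFDerivAt).clm_apply hW.hasFDerivAt
  rw [h.fderiv]
  simp only [Function.comp_apply, ContinuousLinearMap.flip_add, add_apply,
    ContinuousLinearMap.comp_apply, ContinuousLinearMap.flip_apply, hg.fderiv_apply hp, covD,
    map_add]
  ring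

theorem covD_fderiv_comm (hg : IsMetricOn g Ω) (hp : c p ∈ Ω) (hc : ContDiffAt ℝ 2 c p)
    (e f : P) :
    covD g c e (fun q ↦ fderiv ℝ c q f) p = covD g c f (fun q ↦ fderiv ℝ c q e) p := by
  have hd : ∀ a b, fderiv ℝ (fun q ↦ fderiv ℝ c q a) p b = fderiv ℝ (fderiv ℝ c) p b a := by
    intro a b
    rw [((hasFDerivAt_fderiv hc).clm_apply (hasFDerivAt_const a p)).fderiv]
    simp
  rw [covD, covD, hd, hd, fderiv_fderiv_comm hc, hg.christoffelMap_comm hp]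

theorem fderiv_covD (hg : IsMetricOn g Ω) (hp : c p ∈ Ω) (hc : ContDiffAt ℝ 2 c p)
    (hV : ContDiffAt ℝ 2 V p) (e f : P) :
    fderiv ℝ (covD g c f V) p e =
      fderiv ℝ (fderiv ℝ V) p e f
        + fderiv ℝ (christoffelMap g) (c p) (fderiv ℝ c p e) (fderiv ℝ c p f) (V p)
        + christoffelMap g (c p) (fderiv ℝ (fderiv ℝ c) p e f) (V p)
        + christoffelMap g (c p) (fderiv ℝ c p f) (fderiv ℝ V p e) := by
  have hc' := (hc.differentiableAt (by simp)).hasFDerivAt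
  have hV' := (hV.differentiableAt (by simp)).hasFDerivAt
  have h : HasFDerivAt (covD g c f V) _ p :=
    ((hasFDerivAt_fderiv hV).clm_apply (hasFDerivAt_const f p)).add
      ((((hg.differentiableAt_christoffelMap hp).hasFDerivAt.comp p hc').clm_apply
        ((hasFDerivAt_fderiv hc).clm_apply (hasFDerivAt_const f p))).clm_apply hV')
  rw [h.fderiv]
  simp only [ContinuousLinearMap.comp_zero, zero_add, Function.comp_apply,
    ContinuousLinearMap.flip_add, add_apply, ContinuousLinearMap.flip_apply,
    ContinuousLinearMap.comp_apply]
  abel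

theorem covD_covD (hg : IsMetricOn g Ω) (hp : c p ∈ Ω) (hc : ContDiffAt ℝ 2 c p)
    (hV : ContDiffAt ℝ 2 V p) (e f : P) :
    covD g c e (covD g c f V) p =
      covD g c f (covD g c e V) p +
        curvatureMap g (c p) (fderiv ℝ c p f) (fderiv ℝ c p e) (V p) := by
  have hcov : ∀ e f, covD g c e (covD g c f V) p = fderiv ℝ (covD g c f V) p e +
      christoffelMap g (c p) (fderiv ℝ c p e) (covD g c f V p) := fun _ _ ↦ rfl
  rw [hcov, hcov, hg.fderiv_covD hp hc hV, hg.fderiv_covD hp hc hV, fderiv_fderiv_comm hc e f,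
    fderiv_fderiv_comm hV e f, curvatureMap_apply]
  simp only [covD, map_add]
  abel

theorem covD_curvatureMap (hg : IsMetricOn g Ω) (hR : HasParallelCurvatureOn g Ω) (hp : c p ∈ Ω)
    {X Y Z : P → E} (hc : DifferentiableAt ℝ c p) (hX : DifferentiableAt ℝ X p)
    (hY : DifferentiableAt ℝ Y p) (hZ : DifferentiableAt ℝ Z p) (e : P) :
    covD g c e (fun q ↦ curvatureMap g (c q) (X q) (Y q) (Z q)) p =
      curvatureMap g (c p) (covD g c e X p) (Y p) (Z p)
        + curvatureMap g (c p) (X p) (covD g c e Y p) (Z p)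
        + curvatureMap g (c p) (X p) (Y p) (covD g c e Z p) := by
  have h : HasFDerivAt (fun q ↦ curvatureMap g (c q) (X q) (Y q) (Z q)) _ p :=
    ((((hg.differentiableAt_curvatureMap hp).hasFDerivAt.comp p hc.hasFDerivAt).clm_apply
      hX.hasFDerivAt).clm_apply hY.hasFDerivAt).clm_apply hZ.hasFDerivAt
  have hpar := hR (c p) hp (fderiv ℝ c p e) (X p) (Y p) (Z p)
  rw [← sub_eq_zero] at hpar ⊢
  rw [← hpar]
  simp only [covD, h.fderiv, Function.comp_apply, ContinuousLinearMap.flip_add, add_apply,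
    ContinuousLinearMap.comp_apply, ContinuousLinearMap.flip_apply, map_add]
  abel

end IsMetricOn

end AlongMaps

section CurvatureBound

variable {E : Type*} [NormedAddCommGroup E] [NormedSpace ℝ E]
  {g : E → E →L[ℝ] E →L[ℝ] ℝ} {Ω : Set E} {y : E}

namespace IsMetricOn

theorem nonneg (hg : IsMetricOn g Ω) (hy : y ∈ Ω) (v : E) : 0 ≤ g y v v := by
  rcases eq_or_ne v 0 with rfl | hv
  · simp
  · exact (hg.pos y hy v hv).le

theorem abs_apply_le (hg : IsMetricOn g Ω) (hy : y ∈ Ω) (v w : E) :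
    |g y v w| ≤ √(g y v v) * √(g y w w) := by
  rw [← Real.sqrt_mul (hg.nonneg hy v)]
  exact Real.abs_le_sqrt (LinearMap.BilinForm.apply_sq_le_of_symm
    ((ContinuousLinearMap.coeLM ℝ).comp (g y).toLinearMap) (hg.nonneg hy)
    ⟨hg.symm y hy⟩ v w)

theorem exists_unit (hg : IsMetricOn g Ω) (hy : y ∈ Ω) {v : E} (hv : v ≠ 0) :
    ∃ w, g y w w = 1 ∧ v = √(g y v v) • w := by
  have hpos := hg.pos y hy v hv
  have hsqrt : √(g y v v) ≠ 0 := (Real.sqrt_pos.2 hpos).ne'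
  refine ⟨(√(g y v v))⁻¹ • v, ?_, (smul_inv_smul₀ hsqrt v).symm⟩
  simp only [map_smul, smul_apply, smul_eq_mul]
  rw [← mul_assoc, ← mul_inv, Real.mul_self_sqrt hpos.le, inv_mul_cancel₀ hpos.ne']

theorem apply_trilinear_le (hg : IsMetricOn g Ω) (hy : y ∈ Ω) {Λ : ℝ}
    {R : E →L[ℝ] E →L[ℝ] E →L[ℝ] E}
    (hR : ∀ X Y Z W, g y X X = 1 → g y Y Y = 1 → g y Z Z = 1 → g y W W = 1 →
      g y (R X Y Z) W ≤ Λ) (X Y Z W : E) :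
    g y (R X Y Z) W ≤ Λ * (√(g y X X) * √(g y Y Y) * √(g y Z Z) * √(g y W W)) := by
  rcases eq_or_ne X 0 with rfl | hX
  · simp
  rcases eq_or_ne Y 0 with rfl | hY
  · simp
  rcases eq_or_ne Z 0 with rfl | hZ
  · simp
  rcases eq_or_ne W 0 with rfl | hW
  · simp
  obtain ⟨X', hX₁, hX'⟩ := hg.exists_unit hy hX
  obtain ⟨Y', hY₁, hY'⟩ := hg.exists_unit hy hY
  obtain ⟨Z', hZ₁, hZ'⟩ := hg.exists_unit hy hZ
  obtain ⟨W', hW₁, hW'⟩ := hg.exists_unit hy hW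
  calc g y (R X Y Z) W
    _ = g y (R X' Y' Z') W' *
        (√(g y X X) * √(g y Y Y) * √(g y Z Z) * √(g y W W)) := by
      conv_lhs => rw [hX', hY', hZ', hW']
      simp only [map_smul, smul_apply, smul_eq_mul]
      ring
    _ ≤ _ := by gcongr; exact hR X' Y' Z' W' hX₁ hY₁ hZ₁ hW₁

theorem abs_apply_trilinear_le (hg : IsMetricOn g Ω) (hy : y ∈ Ω) {Λ : ℝ}
    {R : E →L[ℝ] E →L[ℝ] E →L[ℝ] E}
    (hR : ∀ X Y Z W, g y X X = 1 → g y Y Y = 1 → g y Z Z = 1 → g y W W = 1 →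
      g y (R X Y Z) W ≤ Λ) (X Y Z W : E) :
    |g y (R X Y Z) W| ≤ Λ * (√(g y X X) * √(g y Y Y) * √(g y Z Z) * √(g y W W)) := by
  have hneg := hg.apply_trilinear_le hy hR X Y Z (-W)
  simp only [map_neg, neg_apply, neg_neg] at hneg
  exact abs_le.2 ⟨by linarith, hg.apply_trilinear_le hy hR X Y Z W⟩

end IsMetricOn

end CurvatureBound

section LocalFlow

variable {E : Type*} [NormedAddCommGroup E] [NormedSpace ℝ E]

/-- A curve shortening flow in coordinates: `g` is the metric, `c` the flow as a function of
`(u, t) ∈ U`, `v` the speed and `a l` the `l`-th arc length derivative of the unit tangent. -/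
structure IsLocalFlow (g : E → E →L[ℝ] E →L[ℝ] ℝ) (Ω : Set E) (U : Set (ℝ × ℝ)) (c : ℝ × ℝ → E)
    (v : ℝ × ℝ → ℝ) (a : ℕ → ℝ × ℝ → E) : Prop where
  isMetricOn : IsMetricOn g Ω
  hasParallelCurvatureOn : HasParallelCurvatureOn g Ω
  isOpen : IsOpen U
  mapsTo : MapsTo c U Ω
  contDiffOn : ContDiffOn ℝ ∞ c U
  contDiffOn_speed : ContDiffOn ℝ ∞ v U
  speed_pos : ∀ p ∈ U, 0 < v p
  speed_smul_zero : ∀ p ∈ U, v p • a 0 p = fderiv ℝ c p (1, 0)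
  unit : ∀ p ∈ U, g (c p) (a 0 p) (a 0 p) = 1
  contDiffOn_coord : ∀ l, ContDiffOn ℝ ∞ (a l) U
  speed_smul_succ : ∀ l, ∀ p ∈ U, v p • a (l + 1) p = covD g c (1, 0) (a l) p
  evolution : ∀ p ∈ U, fderiv ℝ c p (0, 1) = a 1 p

/-- The vector field along `c` represented by a monomial in the fields `a l`. -/
def ReactionTerm.eval (g : E → E →L[ℝ] E →L[ℝ] ℝ) (c : ℝ × ℝ → E) (a : ℕ → ℝ × ℝ → E) :
    ReactionTerm → ℝ × ℝ → E
  | gram i j m => fun p ↦ g (c p) (a (i + 1) p) (a (j + 1) p) • a m p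
  | curv i j m => fun p ↦ curvatureMap g (c p) (a i p) (a (j + 1) p) (a m p)

/-- The vector field along `c` represented by a sum of monomials in the fields `a l`. -/
def evalSum (g : E → E →L[ℝ] E →L[ℝ] ℝ) (c : ℝ × ℝ → E) (a : ℕ → ℝ × ℝ → E)
    (L : List ReactionTerm) (p : ℝ × ℝ) : E :=
  (L.map fun q ↦ q.eval g c a p).sum

variable {g : E → E →L[ℝ] E →L[ℝ] ℝ} {Ω : Set E} {U : Set (ℝ × ℝ)} {c : ℝ × ℝ → E}
  {v : ℝ × ℝ → ℝ} {a : ℕ → ℝ × ℝ → E} {p : ℝ × ℝ}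

theorem evalSum_nil : evalSum g c a [] = fun _ ↦ 0 :=
  rfl

theorem evalSum_cons (q : ReactionTerm) (L : List ReactionTerm) :
    evalSum g c a (q :: L) = fun p ↦ q.eval g c a p + evalSum g c a L p :=
  rfl

theorem evalSum_reaction_zero : evalSum g c a (reaction 0) p = g (c p) (a 1 p) (a 1 p) • a 0 p :=
  add_zero _

theorem evalSum_reaction_succ (l : ℕ) :
    evalSum g c a (reaction (l + 1)) p =
      evalSum g c a ((reaction l).flatMap ReactionTerm.derivative) p +
        (g (c p) (a 1 p) (a 1 p) • a (l + 1) p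
          + curvatureMap g (c p) (a 0 p) (a 1 p) (a l p)) := by
  simp [reaction, evalSum, ReactionTerm.eval]

namespace IsLocalFlow

theorem contDiffAt {F : Type*} [NormedAddCommGroup F] [NormedSpace ℝ F]
    (h : IsLocalFlow g Ω U c v a) {f : ℝ × ℝ → F} (hf : ContDiffOn ℝ ∞ f U) (hp : p ∈ U) :
    ContDiffAt ℝ 2 f p :=
  (hf.contDiffAt (h.isOpen.mem_nhds hp)).of_le (by norm_cast)

theorem differentiableAt {F : Type*} [NormedAddCommGroup F] [NormedSpace ℝ F]
    (h : IsLocalFlow g Ω U c v a) {f : ℝ × ℝ → F} (hf : ContDiffOn ℝ ∞ f U) (hp : p ∈ U) :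
    DifferentiableAt ℝ f p :=
  (h.contDiffAt hf hp).differentiableAt (by simp)

theorem covD_speed_smul (h : IsLocalFlow g Ω U c v a) (l : ℕ) (hp : p ∈ U) (e : ℝ × ℝ) :
    covD g c e (fun q ↦ v q • a l q) p = fderiv ℝ v p e • a l p + v p • covD g c e (a l) p :=
  covD_smul (h.differentiableAt h.contDiffOn_speed hp)
    (h.differentiableAt (h.contDiffOn_coord l) hp) e

theorem abs_apply_evalSum_le (h : IsLocalFlow g Ω U c v a) {Λ : ℝ}
    (hR : ∀ y ∈ Ω, ∀ X Y Z W, g y X X = 1 → g y Y Y = 1 → g y Z Z = 1 → g y W W = 1 →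
      g y (curvatureMap g y X Y Z) W ≤ Λ) (hp : p ∈ U) (l : ℕ) (L : List ReactionTerm) :
    |g (c p) (evalSum g c a L p) (a l p)| ≤
      (L.map (ReactionTerm.bound Λ (fun i j ↦ g (c p) (a i p) (a j p)) l)).sum := by
  have hy := h.mapsTo hp
  induction L with
  | nil => simp [evalSum]
  | cons q L ih =>
    rw [evalSum_cons, List.map_cons, List.sum_cons, map_add, add_apply]
    refine (abs_add_le _ _).trans (add_le_add ?_ ih)
    cases q with
    | gram i j m => simp [ReactionTerm.eval, ReactionTerm.bound, abs_mul]
    | curv i j m => exact h.isMetricOn.abs_apply_trilinear_le hy (hR _ hy) _ _ _ _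

variable [FiniteDimensional ℝ E]

theorem fderiv_gram (h : IsLocalFlow g Ω U c v a) (i j : ℕ) (hp : p ∈ U) (e : ℝ × ℝ) :
    fderiv ℝ (fun q ↦ g (c q) (a i q) (a j q)) p e =
      g (c p) (covD g c e (a i) p) (a j p) + g (c p) (a i p) (covD g c e (a j) p) :=
  h.isMetricOn.fderiv_comp (h.mapsTo hp) (h.differentiableAt h.contDiffOn hp)
    (h.differentiableAt (h.contDiffOn_coord i) hp) (h.differentiableAt (h.contDiffOn_coord j) hp) e

theorem fderiv_gram_fst (h : IsLocalFlow g Ω U c v a) (i j : ℕ) (hp : p ∈ U) :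
    fderiv ℝ (fun q ↦ g (c q) (a i q) (a j q)) p (1, 0) =
      v p * (g (c p) (a (i + 1) p) (a j p) + g (c p) (a i p) (a (j + 1) p)) := by
  rw [h.fderiv_gram i j hp, ← h.speed_smul_succ i p hp, ← h.speed_smul_succ j p hp]
  simp only [map_smul, smul_apply, smul_eq_mul, mul_add]

theorem gram_zero_one (h : IsLocalFlow g Ω U c v a) (hp : p ∈ U) :
    g (c p) (a 0 p) (a 1 p) = 0 := by
  have hconst : (fun q ↦ g (c q) (a 0 q) (a 0 q)) =ᶠ[nhds p] fun _ ↦ (1 : ℝ) :=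
    Filter.eventuallyEq_of_mem (h.isOpen.mem_nhds hp) h.unit
  have hderiv := h.fderiv_gram_fst 0 0 hp
  rw [hconst.fderiv_eq, h.isMetricOn.symm _ (h.mapsTo hp) (a (0 + 1) p)] at hderiv
  simpa [(h.speed_pos p hp).ne'] using hderiv

theorem gram_zero_two (h : IsLocalFlow g Ω U c v a) (hp : p ∈ U) :
    g (c p) (a 0 p) (a 2 p) = -g (c p) (a 1 p) (a 1 p) := by
  have hconst : (fun q ↦ g (c q) (a 0 q) (a 1 q)) =ᶠ[nhds p] fun _ ↦ (0 : ℝ) :=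
    Filter.eventuallyEq_of_mem (h.isOpen.mem_nhds hp) fun q hq ↦ h.gram_zero_one hq
  have hderiv := h.fderiv_gram_fst 0 1 hp
  rw [hconst.fderiv_eq] at hderiv
  have hsum : g (c p) (a 1 p) (a 1 p) + g (c p) (a 0 p) (a 2 p) = 0 := by
    simpa [(h.speed_pos p hp).ne'] using hderiv
  exact (neg_eq_of_add_eq_zero_right hsum).symm

theorem isTangentGram (h : IsLocalFlow g Ω U c v a) (hp : p ∈ U) :
    IsTangentGram fun i j ↦ g (c p) (a i p) (a j p) where
  symm _ _ := h.isMetricOn.symm _ (h.mapsTo hp) _ _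
  abs_le _ _ := h.isMetricOn.abs_apply_le (h.mapsTo hp) _ _
  zero_zero := h.unit p hp
  zero_one := h.gram_zero_one hp
  zero_two := h.gram_zero_two hp

theorem covD_snd_fderiv_fst (h : IsLocalFlow g Ω U c v a) (hp : p ∈ U) :
    covD g c (0, 1) (fun q ↦ fderiv ℝ c q (1, 0)) p = v p • a 2 p := by
  rw [h.isMetricOn.covD_fderiv_comm (h.mapsTo hp) (h.contDiffAt h.contDiffOn hp),
    covD_congr h.isOpen hp h.evolution, h.speed_smul_succ 1 p hp]

theorem covD_snd_speed_smul_zero (h : IsLocalFlow g Ω U c v a) (hp : p ∈ U) :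
    fderiv ℝ v p (0, 1) • a 0 p + v p • covD g c (0, 1) (a 0) p = v p • a 2 p := by
  rw [← h.covD_speed_smul 0 hp, covD_congr h.isOpen hp h.speed_smul_zero,
    h.covD_snd_fderiv_fst hp]

theorem fderiv_speed_snd (h : IsLocalFlow g Ω U c v a) (hp : p ∈ U) :
    fderiv ℝ v p (0, 1) = -g (c p) (a 1 p) (a 1 p) * v p := by
  have hy := h.mapsTo hp
  have horth : g (c p) (a 0 p) (covD g c (0, 1) (a 0) p) = 0 := by
    have hconst : (fun q ↦ g (c q) (a 0 q) (a 0 q)) =ᶠ[nhds p] fun _ ↦ (1 : ℝ) :=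
      Filter.eventuallyEq_of_mem (h.isOpen.mem_nhds hp) h.unit
    have hderiv := h.fderiv_gram 0 0 hp (0, 1)
    rw [hconst.fderiv_eq, h.isMetricOn.symm _ hy (covD g c (0, 1) (a 0) p)] at hderiv
    simpa using hderiv.symm
  have heq := congr(g (c p) (a 0 p) $(h.covD_snd_speed_smul_zero hp))
  simp only [map_add, map_smul, smul_eq_mul, h.unit p hp, horth, h.gram_zero_two hp] at heq
  linarith

theorem contDiffOn_eval (h : IsLocalFlow g Ω U c v a) (q : ReactionTerm) :
    ContDiffOn ℝ ∞ (q.eval g c a) U := by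
  have ha := h.contDiffOn_coord
  cases q with
  | gram i j m =>
    exact (((h.isMetricOn.contDiffOn.comp h.contDiffOn h.mapsTo).clm_apply (ha _)).clm_apply
      (ha _)).smul (ha _)
  | curv i j m =>
    exact (((h.isMetricOn.contDiffOn_curvatureMap.comp h.contDiffOn h.mapsTo).clm_apply
      (ha _)).clm_apply (ha _)).clm_apply (ha _)

theorem contDiffOn_evalSum (h : IsLocalFlow g Ω U c v a) (L : List ReactionTerm) :
    ContDiffOn ℝ ∞ (evalSum g c a L) U := by
  induction L with
  | nil => exact contDiffOn_const
  | cons q L ih => exact (h.contDiffOn_eval q).add ih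

theorem covD_eval (h : IsLocalFlow g Ω U c v a) (q : ReactionTerm) (hp : p ∈ U) :
    covD g c (1, 0) (q.eval g c a) p = v p • evalSum g c a q.derivative p := by
  have hy := h.mapsTo hp
  have ha := fun l ↦ h.differentiableAt (h.contDiffOn_coord l) hp
  have hc := h.differentiableAt h.contDiffOn hp
  cases q with
  | gram i j m =>
    simp only [ReactionTerm.eval, ReactionTerm.derivative, evalSum_cons, evalSum_nil]
    rw [covD_smul (h.isMetricOn.differentiableAt_comp hy hc (ha _) (ha _)) (ha _),
      h.fderiv_gram_fst _ _ hp, ← h.speed_smul_succ m p hp]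
    module
  | curv i j m =>
    simp only [ReactionTerm.eval, ReactionTerm.derivative, evalSum_cons, evalSum_nil]
    rw [h.isMetricOn.covD_curvatureMap h.hasParallelCurvatureOn hy hc (ha _) (ha _) (ha _),
      ← h.speed_smul_succ m p hp, ← h.speed_smul_succ i p hp, ← h.speed_smul_succ (j + 1) p hp]
    simp only [map_smul, smul_apply]
    module

theorem covD_evalSum (h : IsLocalFlow g Ω U c v a) (L : List ReactionTerm) (hp : p ∈ U) :
    covD g c (1, 0) (evalSum g c a L) p =
      v p • evalSum g c a (L.flatMap ReactionTerm.derivative) p := by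
  induction L with
  | nil => simp [covD, evalSum_nil]
  | cons q L ih =>
    rw [evalSum_cons, covD_add (h.differentiableAt (h.contDiffOn_eval q) hp)
      (h.differentiableAt (h.contDiffOn_evalSum L) hp), ih, h.covD_eval q hp, ← smul_add]
    simp [evalSum]

/-- The formula for `[D_t, D/∂s]`, with both sides multiplied by the speed so that no inverse
occurs. -/
theorem speed_smul_covD_snd_succ (h : IsLocalFlow g Ω U c v a) (l : ℕ) (hp : p ∈ U) :
    v p • covD g c (0, 1) (a (l + 1)) p =
      covD g c (1, 0) (covD g c (0, 1) (a l)) p +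
        v p • (g (c p) (a 1 p) (a 1 p) • a (l + 1) p
          + curvatureMap g (c p) (a 0 p) (a 1 p) (a l p)) := by
  have hcomm := h.isMetricOn.covD_covD (h.mapsTo hp) (h.contDiffAt h.contDiffOn hp)
    (h.contDiffAt (h.contDiffOn_coord l) hp) (0, 1) (1, 0)
  rw [← covD_congr h.isOpen hp (h.speed_smul_succ l), h.covD_speed_smul (l + 1) hp,
    h.fderiv_speed_snd hp, h.evolution p hp, ← h.speed_smul_zero p hp] at hcomm
  simp only [map_smul, smul_apply] at hcomm
  rw [← sub_eq_zero] at hcomm ⊢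
  rw [← hcomm]
  module

theorem covD_snd (h : IsLocalFlow g Ω U c v a) (l : ℕ) :
    ∀ p ∈ U, covD g c (0, 1) (a l) p = a (l + 2) p + evalSum g c a (reaction l) p := by
  induction l with
  | zero =>
    intro p hp
    refine smul_right_injective E (h.speed_pos p hp).ne' ?_
    have heq := h.covD_snd_speed_smul_zero hp
    rw [h.fderiv_speed_snd hp] at heq
    simp only [evalSum_reaction_zero, zero_add, smul_add, ← heq]
    module
  | succ l ih =>
    intro p hp
    refine smul_right_injective E (h.speed_pos p hp).ne' ?_
    have hcov : covD g c (1, 0) (covD g c (0, 1) (a l)) p =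
        v p • a (l + 3) p +
          v p • evalSum g c a ((reaction l).flatMap ReactionTerm.derivative) p := by
      rw [covD_congr h.isOpen hp ih,
        covD_add (h.differentiableAt (h.contDiffOn_coord _) hp)
          (h.differentiableAt (h.contDiffOn_evalSum _) hp),
        h.covD_evalSum _ hp, ← h.speed_smul_succ (l + 2) p hp]
    simp only [h.speed_smul_covD_snd_succ l hp, hcov, evalSum_reaction_succ, smul_add]
    abel

theorem fderiv_gram_snd (h : IsLocalFlow g Ω U c v a) (l : ℕ) (hp : p ∈ U) :
    fderiv ℝ (fun q ↦ g (c q) (a l q) (a l q)) p (0, 1) =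
      2 * g (c p) (a (l + 2) p) (a l p) + 2 * g (c p) (evalSum g c a (reaction l) p) (a l p) := by
  rw [h.fderiv_gram l l hp, h.isMetricOn.symm _ (h.mapsTo hp) (a l p), h.covD_snd l p hp, map_add,
    add_apply]
  ring

end IsLocalFlow

end LocalFlow

section ChartDerivatives

variable {E : Type*} [NormedAddCommGroup E] [NormedSpace ℝ E]
  {M : Type*} [TopologicalSpace M] [ChartedSpace E M]

/-- The differential of the chart at `x₀`, as a linear map of the model space. -/
def chartD (x₀ x : M) : E →L[ℝ] E := mfderiv 𝓘(ℝ, E) 𝓘(ℝ, E) (extChartAt 𝓘(ℝ, E) x₀) x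

/-- The differential of the inverse of the chart at `x₀`, as a linear map of the model space. -/
def chartSymmD (x₀ : M) (y : E) : E →L[ℝ] E :=
  mfderiv 𝓘(ℝ, E) 𝓘(ℝ, E) (extChartAt 𝓘(ℝ, E) x₀).symm y

/-- The transition map from the chart at `x₀` to the chart at `x₁`. -/
def transition (x₀ x₁ : M) (y : E) : E :=
  extChartAt 𝓘(ℝ, E) x₁ ((extChartAt 𝓘(ℝ, E) x₀).symm y)

theorem transition_extChartAt {x₀ x : M} (hx : x ∈ (extChartAt 𝓘(ℝ, E) x₀).source) (x₁ : M) :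
    transition x₀ x₁ (extChartAt 𝓘(ℝ, E) x₀ x) = extChartAt 𝓘(ℝ, E) x₁ x := by
  rw [transition, (extChartAt 𝓘(ℝ, E) x₀).left_inv hx]

theorem metric_eq_inner [RiemannianBundle (fun x : M ↦ TangentSpace 𝓘(ℝ, E) x)] (x₀ : M)
    (y v w : E) :
    metric x₀ y v w = inner ℝ
      (show TangentSpace 𝓘(ℝ, E) ((extChartAt 𝓘(ℝ, E) x₀).symm y) from chartSymmD x₀ y v)
      (show TangentSpace 𝓘(ℝ, E) ((extChartAt 𝓘(ℝ, E) x₀).symm y) from chartSymmD x₀ y w) :=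
  rfl

variable [IsManifold 𝓘(ℝ, E) ∞ M] {x₀ x₁ x : M} {y : E}

theorem mdifferentiableAt_chart (hx : x ∈ (extChartAt 𝓘(ℝ, E) x₀).source) :
    MDifferentiableAt 𝓘(ℝ, E) 𝓘(ℝ, E) (extChartAt 𝓘(ℝ, E) x₀) x :=
  mdifferentiableAt_extChartAt (by rwa [extChartAt_source] at hx)

theorem mdifferentiableAt_chart_symm (hy : y ∈ (extChartAt 𝓘(ℝ, E) x₀).target) :
    MDifferentiableAt 𝓘(ℝ, E) 𝓘(ℝ, E) (extChartAt 𝓘(ℝ, E) x₀).symm y :=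
  (mdifferentiableOn_extChartAt_symm y hy).mdifferentiableAt
    ((isOpen_extChartAt_target x₀).mem_nhds hy)

theorem chartD_chartSymmD (hy : y ∈ (extChartAt 𝓘(ℝ, E) x₀).target) (v : E) :
    chartD x₀ ((extChartAt 𝓘(ℝ, E) x₀).symm y) (chartSymmD x₀ y v) = v := by
  have h := mfderiv_extChartAt_comp_mfderivWithin_extChartAt_symm (I := 𝓘(ℝ, E)) hy
  rw [ModelWithCorners.range_eq_univ, mfderivWithin_univ] at h
  exact congr($h v)

theorem chartSymmD_chartD (hx : x ∈ (extChartAt 𝓘(ℝ, E) x₀).source) (v : E) :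
    chartSymmD x₀ (extChartAt 𝓘(ℝ, E) x₀ x) (chartD x₀ x v) = v := by
  have h := mfderivWithin_extChartAt_symm_comp_mfderiv_extChartAt' (I := 𝓘(ℝ, E)) hx
  rw [ModelWithCorners.range_eq_univ, mfderivWithin_univ] at h
  exact congr($h v)

theorem chartD_bijective (hx : x ∈ (extChartAt 𝓘(ℝ, E) x₀).source) :
    Function.Bijective (chartD (E := E) x₀ x) := by
  refine ⟨Function.LeftInverse.injective (chartSymmD_chartD hx),
    Function.RightInverse.surjective (g := chartSymmD x₀ (extChartAt 𝓘(ℝ, E) x₀ x)) fun v ↦ ?_⟩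
  simpa only [(extChartAt 𝓘(ℝ, E) x₀).left_inv hx] using
    chartD_chartSymmD ((extChartAt 𝓘(ℝ, E) x₀).map_source hx) v

theorem contDiffAt_transition (hx₀ : x ∈ (extChartAt 𝓘(ℝ, E) x₀).source)
    (hx₁ : x ∈ (extChartAt 𝓘(ℝ, E) x₁).source) :
    ContDiffAt ℝ ∞ (transition x₀ x₁ : E → E) (extChartAt 𝓘(ℝ, E) x₀ x) := by
  have hsymm : ContMDiffAt 𝓘(ℝ, E) 𝓘(ℝ, E) ∞ (extChartAt 𝓘(ℝ, E) x₀).symm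
      (extChartAt 𝓘(ℝ, E) x₀ x) :=
    (contMDiffOn_extChartAt_symm x₀).contMDiffAt
      ((isOpen_extChartAt_target x₀).mem_nhds ((extChartAt 𝓘(ℝ, E) x₀).map_source hx₀))
  refine (ContMDiffAt.comp _ ?_ hsymm).contDiffAt
  rw [(extChartAt 𝓘(ℝ, E) x₀).left_inv hx₀]
  exact contMDiffAt_extChartAt' (by rwa [extChartAt_source] at hx₁)

theorem fderiv_transition (hy : y ∈ (extChartAt 𝓘(ℝ, E) x₀).target)
    (hx₁ : (extChartAt 𝓘(ℝ, E) x₀).symm y ∈ (extChartAt 𝓘(ℝ, E) x₁).source) (v : E) :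
    fderiv ℝ (transition x₀ x₁ : E → E) y v =
      chartD x₁ ((extChartAt 𝓘(ℝ, E) x₀).symm y) (chartSymmD x₀ y v) := by
  have h := mfderiv_comp y (mdifferentiableAt_chart hx₁) (mdifferentiableAt_chart_symm hy)
  rw [mfderiv_eq_fderiv] at h
  exact congr($h v)

theorem fderiv_transition_chartD (hx₀ : x ∈ (extChartAt 𝓘(ℝ, E) x₀).source)
    (hx₁ : x ∈ (extChartAt 𝓘(ℝ, E) x₁).source) (v : E) :
    fderiv ℝ (transition x₀ x₁ : E → E) (extChartAt 𝓘(ℝ, E) x₀ x) (chartD x₀ x v) =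
      chartD x₁ x v := by
  have hinv := (extChartAt 𝓘(ℝ, E) x₀).left_inv hx₀
  rw [fderiv_transition ((extChartAt 𝓘(ℝ, E) x₀).map_source hx₀) (by rwa [hinv]),
    chartSymmD_chartD hx₀, hinv]

theorem surjective_fderiv_transition (hx₀ : x ∈ (extChartAt 𝓘(ℝ, E) x₀).source)
    (hx₁ : x ∈ (extChartAt 𝓘(ℝ, E) x₁).source) :
    Function.Surjective (fderiv ℝ (transition x₀ x₁ : E → E) (extChartAt 𝓘(ℝ, E) x₀ x)) := by
  intro w
  obtain ⟨v, rfl⟩ := (chartD_bijective hx₁).2 w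
  exact ⟨_, fderiv_transition_chartD hx₀ hx₁ v⟩

theorem contMDiffOn_mfderiv_extChartAt_symm (x₀ : M) (v : E) :
    ContMDiffOn 𝓘(ℝ, E) (𝓘(ℝ, E).prod 𝓘(ℝ, E)) ∞
      (fun y ↦ (⟨(extChartAt 𝓘(ℝ, E) x₀).symm y,
        mfderiv 𝓘(ℝ, E) 𝓘(ℝ, E) (extChartAt 𝓘(ℝ, E) x₀).symm y v⟩ :
        TotalSpace E (fun x : M ↦ TangentSpace 𝓘(ℝ, E) x)))
      (extChartAt 𝓘(ℝ, E) x₀).target := by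
  have hbase : ∀ y ∈ (extChartAt 𝓘(ℝ, E) x₀).target,
      (extChartAt 𝓘(ℝ, E) x₀).symm y ∈ (chartAt E x₀).source := fun y hy ↦ by
    simpa only [extChartAt_source] using (extChartAt 𝓘(ℝ, E) x₀).map_target hy
  rw [(trivializationAt E (fun x : M ↦ TangentSpace 𝓘(ℝ, E) x) x₀).contMDiffOn_iff fun y hy ↦ by
    simpa [Trivialization.mem_source] using hbase y hy]
  refine ⟨contMDiffOn_extChartAt_symm x₀, (contMDiffOn_const (c := v)).congr fun y hy ↦ ?_⟩
  have htriv := TangentBundle.continuousLinearMapAt_trivializationAt (I := 𝓘(ℝ, E)) (hbase y hy)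
  refine (Trivialization.continuousLinearMapAt_apply_of_mem (R := ℝ) _ ?_ _).symm.trans ?_
  · simpa using hbase y hy
  · exact congr($htriv (chartSymmD x₀ y v)).trans (chartD_chartSymmD hy v)

variable [RiemannianBundle (fun x : M ↦ TangentSpace 𝓘(ℝ, E) x)]

theorem metric_chartD (hx : x ∈ (extChartAt 𝓘(ℝ, E) x₀).source) (V W : TangentSpace 𝓘(ℝ, E) x) :
    metric x₀ (extChartAt 𝓘(ℝ, E) x₀ x) (chartD x₀ x V) (chartD x₀ x W) = inner ℝ V W := by
  have hinner : ∀ x', x' = x →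
      (inner ℝ (show TangentSpace 𝓘(ℝ, E) x' from V) (show TangentSpace 𝓘(ℝ, E) x' from W) : ℝ) =
        inner ℝ V W := by
    rintro _ rfl
    rfl
  rw [metric_eq_inner, ← hinner _ ((extChartAt 𝓘(ℝ, E) x₀).left_inv hx)]
  exact congrArg₂ (inner ℝ) (chartSymmD_chartD hx V) (chartSymmD_chartD hx W)

theorem eventually_metric_transition (hx₀ : x ∈ (extChartAt 𝓘(ℝ, E) x₀).source)
    (hx₁ : x ∈ (extChartAt 𝓘(ℝ, E) x₁).source) :
    ∀ᶠ y in nhds (extChartAt 𝓘(ℝ, E) x₀ x), ∀ v w, metric x₀ y v w =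
      metric x₁ (transition x₀ x₁ y) (fderiv ℝ (transition x₀ x₁ : E → E) y v)
        (fderiv ℝ (transition x₀ x₁ : E → E) y w) := by
  have htarget := (extChartAt 𝓘(ℝ, E) x₀).map_source hx₀
  have hsource : (extChartAt 𝓘(ℝ, E) x₁).source ∈
      nhds ((extChartAt 𝓘(ℝ, E) x₀).symm (extChartAt 𝓘(ℝ, E) x₀ x)) := by
    rw [(extChartAt 𝓘(ℝ, E) x₀).left_inv hx₀]
    exact (isOpen_extChartAt_source x₁).mem_nhds hx₁
  filter_upwards [(isOpen_extChartAt_target x₀).mem_nhds htarget,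
    (mdifferentiableAt_chart_symm htarget).continuousAt hsource] with y hy hy₁ v w
  rw [fderiv_transition hy hy₁, fderiv_transition hy hy₁, transition, metric_eq_inner]
  exact (metric_chartD hy₁ _ _).symm

variable [IsContMDiffRiemannianBundle 𝓘(ℝ, E) ∞ E (fun x : M ↦ TangentSpace 𝓘(ℝ, E) x)]

theorem contDiffOn_metric_apply (x₀ : M) (v w : E) :
    ContDiffOn ℝ ∞ (fun y ↦ metric x₀ y v w) (extChartAt 𝓘(ℝ, E) x₀).target :=
  contMDiffOn_iff_contDiffOn.1 <| ContMDiffOn.inner_bundle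
    (E := fun x : M ↦ TangentSpace 𝓘(ℝ, E) x) (b := (extChartAt 𝓘(ℝ, E) x₀).symm)
    (v := fun y ↦ mfderiv 𝓘(ℝ, E) 𝓘(ℝ, E) (extChartAt 𝓘(ℝ, E) x₀).symm y v)
    (w := fun y ↦ mfderiv 𝓘(ℝ, E) 𝓘(ℝ, E) (extChartAt 𝓘(ℝ, E) x₀).symm y w)
    (contMDiffOn_mfderiv_extChartAt_symm x₀ v) (contMDiffOn_mfderiv_extChartAt_symm x₀ w)

variable [FiniteDimensional ℝ E]

theorem isMetricOn_metric (x₀ : M) :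
    IsMetricOn (metric (E := E) x₀) (extChartAt 𝓘(ℝ, E) x₀).target where
  isOpen := isOpen_extChartAt_target x₀
  contDiffOn := contDiffOn_clm_apply.2 fun v ↦ contDiffOn_clm_apply.2 fun w ↦
    contDiffOn_metric_apply x₀ v w
  symm y _ v w := by rw [metric_eq_inner, metric_eq_inner, real_inner_comm]
  pos y hy v hv := by
    rw [metric_eq_inner]
    refine real_inner_self_pos.2 fun h ↦ hv ?_
    rw [← chartD_chartSymmD hy v, show chartSymmD x₀ y v = 0 from h, map_zero]

end ChartDerivatives

section ChartCurvature

variable {E : Type*} [NormedAddCommGroup E] [NormedSpace ℝ E]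
  {M : Type*} [TopologicalSpace M] [ChartedSpace E M]
  [RiemannianBundle (fun x : M ↦ TangentSpace 𝓘(ℝ, E) x)]

theorem christoffelMap_metric (x₀ : M) (y v w : E) :
    christoffelMap (metric x₀) y v w = christoffel x₀ y v w := by
  simp [christoffelMap, christoffel, christoffelLowerMap, christoffelLower]

variable [IsManifold 𝓘(ℝ, E) ∞ M]
  [IsContMDiffRiemannianBundle 𝓘(ℝ, E) ∞ E (fun x : M ↦ TangentSpace 𝓘(ℝ, E) x)]
  [FiniteDimensional ℝ E] {x₀ : M} {y : E}

theorem fderiv_christoffel (hy : y ∈ (extChartAt 𝓘(ℝ, E) x₀).target) (a v w : E) :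
    fderiv ℝ (fun y ↦ christoffel x₀ y v w) y a =
      fderiv ℝ (christoffelMap (metric x₀)) y a v w := by
  have h := (isMetricOn_metric x₀).differentiableAt_christoffelMap hy
  simp only [← christoffelMap_metric]
  rw [fderiv_clm_apply (h.clm_apply (differentiableAt_const v)) (differentiableAt_const w),
    fderiv_clm_apply h (differentiableAt_const v)]
  simp

theorem curvatureMap_metric (hy : y ∈ (extChartAt 𝓘(ℝ, E) x₀).target) (v w z : E) :
    curvatureMap (metric x₀) y v w z = curvature x₀ y v w z := by
  rw [curvatureMap_apply, curvature, fderiv_christoffel hy, fderiv_christoffel hy]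
  simp only [christoffelMap_metric]

theorem fderiv_curvature (hy : y ∈ (extChartAt 𝓘(ℝ, E) x₀).target) (a v w z : E) :
    fderiv ℝ (fun y ↦ curvature x₀ y v w z) y a =
      fderiv ℝ (curvatureMap (metric x₀)) y a v w z := by
  have h := (isMetricOn_metric x₀).differentiableAt_curvatureMap hy
  have heq : (fun y ↦ curvature x₀ y v w z) =ᶠ[nhds y]
      fun y ↦ curvatureMap (metric x₀) y v w z := by
    filter_upwards [(isOpen_extChartAt_target x₀).mem_nhds hy] with y hy
    exact (curvatureMap_metric hy v w z).symm
  rw [heq.fderiv_eq, fderiv_clm_apply ((h.clm_apply (differentiableAt_const v)).clm_apply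
      (differentiableAt_const w)) (differentiableAt_const z),
    fderiv_clm_apply (h.clm_apply (differentiableAt_const v)) (differentiableAt_const w),
    fderiv_clm_apply h (differentiableAt_const v)]
  simp

theorem IsLocallySymmetric.hasParallelCurvatureOn (h : IsLocallySymmetric E M) (x₀ : M) :
    HasParallelCurvatureOn (metric x₀) (extChartAt 𝓘(ℝ, E) x₀).target := by
  intro y hy a v w z
  have hcov := h x₀ y hy a v w z
  rw [covDerivCurvature, fderiv_curvature hy] at hcov
  simp only [curvatureMap_metric hy, christoffelMap_metric]
  rw [← sub_eq_zero, ← hcov]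
  abel

end ChartCurvature

section CovariantDerivative

variable {E : Type*} [NormedAddCommGroup E] [NormedSpace ℝ E]
  {M : Type*} [TopologicalSpace M] [ChartedSpace E M]

theorem coordField_smul (x₀ : M) (c : ℝ → M) (r : ℝ → ℝ) (V : ∀ u, TangentSpace 𝓘(ℝ, E) (c u))
    (u : ℝ) : coordField x₀ c (fun u ↦ r u • V u) u = r u • coordField x₀ c V u :=
  map_smul (chartD (E := E) x₀ (c u)) (r u) (V u)

/-- The covariant derivative of a vector field `V` along `c`, computed in the chart at `x₀`. -/
def coordCovDeriv [RiemannianBundle (fun x : M ↦ TangentSpace 𝓘(ℝ, E) x)] (x₀ : M) (c : ℝ → M)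
    (V : ∀ u, TangentSpace 𝓘(ℝ, E) (c u)) (u : ℝ) : E :=
  deriv (coordField x₀ c V) u +
    christoffel x₀ (extChartAt 𝓘(ℝ, E) x₀ (c u)) (coordField x₀ c (velocity c) u)
      (coordField x₀ c V u)

variable [IsManifold 𝓘(ℝ, E) ∞ M] {x₀ x₁ : M} {c : ℝ → M} {u : ℝ}
  {V : ∀ u, TangentSpace 𝓘(ℝ, E) (c u)}

theorem fderiv_transition_coordField (hx₀ : c u ∈ (extChartAt 𝓘(ℝ, E) x₀).source)
    (hx₁ : c u ∈ (extChartAt 𝓘(ℝ, E) x₁).source) :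
    fderiv ℝ (transition x₀ x₁ : E → E) (extChartAt 𝓘(ℝ, E) x₀ (c u)) (coordField x₀ c V u) =
      coordField x₁ c V u :=
  fderiv_transition_chartD hx₀ hx₁ (V u)

theorem hasDerivWithinAt_extChartAt_comp {s : Set ℝ} {c' : ℝ →L[ℝ] TangentSpace 𝓘(ℝ, E) (c u)}
    (hc : HasMFDerivWithinAt 𝓘(ℝ, ℝ) 𝓘(ℝ, E) c s u c')
    (hx : c u ∈ (extChartAt 𝓘(ℝ, E) x₀).source) :
    HasDerivWithinAt (fun u ↦ extChartAt 𝓘(ℝ, E) x₀ (c u)) (chartD x₀ (c u) (c' 1)) s u := by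
  have hcomp : HasFDerivWithinAt (fun u ↦ extChartAt 𝓘(ℝ, E) x₀ (c u))
      (chartD x₀ (c u) ∘L (show ℝ →L[ℝ] E from c')) s u :=
    hasMFDerivWithinAt_iff_hasFDerivWithinAt.1
      ((mdifferentiableAt_chart hx).hasMFDerivAt.comp_hasMFDerivWithinAt u hc)
  exact hcomp.hasDerivWithinAt

theorem hasDerivAt_extChartAt_comp (hc : MDifferentiableAt 𝓘(ℝ, ℝ) 𝓘(ℝ, E) c u)
    (hx : c u ∈ (extChartAt 𝓘(ℝ, E) x₀).source) :
    HasDerivAt (fun u ↦ extChartAt 𝓘(ℝ, E) x₀ (c u)) (coordField x₀ c (velocity c) u) u := by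
  rw [← hasDerivWithinAt_univ]
  exact hasDerivWithinAt_extChartAt_comp hc.hasMFDerivAt.hasMFDerivWithinAt hx

theorem hasDerivAt_apply_comp {F G : Type*} [NormedAddCommGroup F] [NormedSpace ℝ F]
    [NormedAddCommGroup G] [NormedSpace ℝ G] {T : E → F →L[ℝ] G} {T' : E →L[ℝ] F →L[ℝ] G}
    {y : ℝ → E} {y' : E} {a : ℝ → F} {a' : F} {u : ℝ} (hT : HasFDerivAt T T' (y u))
    (hy : HasDerivAt y y' u) (ha : HasDerivAt a a' u) :
    HasDerivAt (fun u ↦ T (y u) (a u)) (T' y' (a u) + T (y u) a') u :=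
  (hT.comp_hasDerivAt u hy).clm_apply ha

theorem hasDerivAt_coordField_transition (hc : MDifferentiableAt 𝓘(ℝ, ℝ) 𝓘(ℝ, E) c u)
    (hx₀ : c u ∈ (extChartAt 𝓘(ℝ, E) x₀).source) (hx₁ : c u ∈ (extChartAt 𝓘(ℝ, E) x₁).source)
    (hV : DifferentiableAt ℝ (coordField x₀ c V) u) :
    HasDerivAt (coordField x₁ c V)
      (fderiv ℝ (fderiv ℝ (transition x₀ x₁ : E → E)) (extChartAt 𝓘(ℝ, E) x₀ (c u))
          (coordField x₀ c (velocity c) u) (coordField x₀ c V u) +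
        fderiv ℝ (transition x₀ x₁ : E → E) (extChartAt 𝓘(ℝ, E) x₀ (c u))
          (deriv (coordField x₀ c V) u)) u := by
  have heq : coordField x₁ c V =ᶠ[nhds u] fun u ↦
      fderiv ℝ (transition x₀ x₁ : E → E) (extChartAt 𝓘(ℝ, E) x₀ (c u)) (coordField x₀ c V u) := by
    filter_upwards [hc.continuousAt ((isOpen_extChartAt_source x₀).mem_nhds hx₀),
      hc.continuousAt ((isOpen_extChartAt_source x₁).mem_nhds hx₁)] with u hu₀ hu₁
    exact (fderiv_transition_coordField hu₀ hu₁).symm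
  have hθ := hasFDerivAt_fderiv ((contDiffAt_transition hx₀ hx₁).of_le (by norm_cast))
  exact (hasDerivAt_apply_comp hθ (hasDerivAt_extChartAt_comp hc hx₀)
    hV.hasDerivAt).congr_of_eventuallyEq heq

variable [RiemannianBundle (fun x : M ↦ TangentSpace 𝓘(ℝ, E) x)]

theorem coordField_covDeriv_self (c : ℝ → M) (V : ∀ u, TangentSpace 𝓘(ℝ, E) (c u)) (u : ℝ) :
    coordField (c u) c (covDeriv c V) u = coordCovDeriv (c u) c V u := by
  obtain ⟨e, he⟩ : (chartD (E := E) (c u) (c u)).IsInvertible :=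
    isInvertible_mfderiv_extChartAt (I := 𝓘(ℝ, E)) (mem_extChartAt_source (I := 𝓘(ℝ, E)) (c u))
  have hinverse : ∀ w, chartD (c u) (c u) ((chartD (E := E) (c u) (c u)).inverse w) = w := by
    simp [← he]
  exact hinverse (coordCovDeriv (c u) c V u)

variable [FiniteDimensional ℝ E]
  [IsContMDiffRiemannianBundle 𝓘(ℝ, E) ∞ E (fun x : M ↦ TangentSpace 𝓘(ℝ, E) x)]

theorem fderiv_transition_coordCovDeriv (hc : MDifferentiableAt 𝓘(ℝ, ℝ) 𝓘(ℝ, E) c u)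
    (hx₀ : c u ∈ (extChartAt 𝓘(ℝ, E) x₀).source) (hx₁ : c u ∈ (extChartAt 𝓘(ℝ, E) x₁).source)
    (hV : DifferentiableAt ℝ (coordField x₀ c V) u) :
    fderiv ℝ (transition x₀ x₁ : E → E) (extChartAt 𝓘(ℝ, E) x₀ (c u)) (coordCovDeriv x₀ c V u) =
      coordCovDeriv x₁ c V u := by
  have hθ := transition_extChartAt hx₀ x₁
  have hlaw := (isMetricOn_metric x₀).fderiv_christoffelMap_of_pullback (isMetricOn_metric x₁)
    ((extChartAt 𝓘(ℝ, E) x₀).map_source hx₀)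
    (by rw [hθ]; exact (extChartAt 𝓘(ℝ, E) x₁).map_source hx₁)
    ((contDiffAt_transition hx₀ hx₁).of_le (by norm_cast)) (surjective_fderiv_transition hx₀ hx₁)
    (eventually_metric_transition hx₀ hx₁) (coordField x₀ c (velocity c) u) (coordField x₀ c V u)
  rw [fderiv_transition_coordField hx₀ hx₁, fderiv_transition_coordField hx₀ hx₁, hθ,
    christoffelMap_metric, christoffelMap_metric] at hlaw
  rw [coordCovDeriv, coordCovDeriv, map_add, hlaw,
    (hasDerivAt_coordField_transition hc hx₀ hx₁ hV).deriv]
  abel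

theorem coordField_covDeriv (hc : MDifferentiableAt 𝓘(ℝ, ℝ) 𝓘(ℝ, E) c u)
    (hx : c u ∈ (extChartAt 𝓘(ℝ, E) x₀).source)
    (hV : DifferentiableAt ℝ (coordField x₀ c V) u) :
    coordField x₀ c (covDeriv c V) u = coordCovDeriv x₀ c V u := by
  have hself : c u ∈ (extChartAt 𝓘(ℝ, E) (c u)).source := mem_extChartAt_source (c u)
  have hinj : Function.Injective
      (fderiv ℝ (transition x₀ (c u) : E → E) (extChartAt 𝓘(ℝ, E) x₀ (c u))) :=
    LinearMap.injective_iff_surjective.2 (surjective_fderiv_transition hx hself)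
  apply hinj
  rw [fderiv_transition_coordField hx hself, coordField_covDeriv_self,
    fderiv_transition_coordCovDeriv hc hx hself hV]

end CovariantDerivative

section Strip

variable {F : Type*} [NormedAddCommGroup F] [NormedSpace ℝ F] {S : Set (ℝ × ℝ)} {f : ℝ × ℝ → F}
  {f' : ℝ × ℝ →L[ℝ] F} {p : ℝ × ℝ}

theorem hasDerivAt_fst_of_hasFDerivWithinAt (hf : HasFDerivWithinAt f f' S p)
    (hS : ∀ᶠ u in nhds p.1, (u, p.2) ∈ S) : HasDerivAt (fun u ↦ f (u, p.2)) (f' (1, 0)) p.1 :=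
  hf.comp_hasDerivAt p.1 ((hasDerivAt_id p.1).prodMk (hasDerivAt_const p.1 p.2)) hS

theorem hasDerivAt_fst (hf : DifferentiableAt ℝ f p) :
    HasDerivAt (fun u ↦ f (u, p.2)) (fderiv ℝ f p (1, 0)) p.1 :=
  hasDerivAt_fst_of_hasFDerivWithinAt (S := univ) hf.hasFDerivAt.hasFDerivWithinAt
    (.of_forall fun _ ↦ mem_univ _)

theorem hasDerivAt_snd (hf : DifferentiableAt ℝ f p) :
    HasDerivAt (fun t ↦ f (p.1, t)) (fderiv ℝ f p (0, 1)) p.2 :=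
  HasFDerivAt.comp_hasDerivAt (f := fun t : ℝ ↦ (p.1, t)) p.2 hf.hasFDerivAt
    ((hasDerivAt_const p.2 p.1).prodMk (hasDerivAt_id p.2))

theorem hasDerivAt_fst_fderivWithin (hf : ContDiffOn ℝ ∞ f S) (hp : p ∈ S)
    (hS : ∀ᶠ u in nhds p.1, (u, p.2) ∈ S) :
    HasDerivAt (fun u ↦ f (u, p.2)) (fderivWithin ℝ f S p (1, 0)) p.1 :=
  hasDerivAt_fst_of_hasFDerivWithinAt (hf.differentiableOn (by simp) p hp).hasFDerivWithinAt hS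

theorem contDiffOn_deriv_fst (hf : ContDiffOn ℝ ∞ f S) (hunique : UniqueDiffOn ℝ S)
    (hS : ∀ p ∈ S, ∀ᶠ u in nhds p.1, (u, p.2) ∈ S) :
    ContDiffOn ℝ ∞ (fun p ↦ deriv (fun u ↦ f (u, p.2)) p.1) S :=
  ((hf.fderivWithin hunique (by simp)).clm_apply contDiffOn_const).congr fun p hp ↦
    (hasDerivAt_fst_fderivWithin hf hp (hS p hp)).deriv

end Strip

section FlowCoordinates

variable {E : Type*} [NormedAddCommGroup E] [NormedSpace ℝ E]
  {M : Type*} [TopologicalSpace M] [ChartedSpace E M] {J : Set ℝ} {γ : Circle × ℝ → M}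
  {x₀ : M} {p : ℝ × ℝ}

/-- The family of curves `γ` as a map of the angle and the time. -/
def flowMap (γ : Circle × ℝ → M) (p : ℝ × ℝ) : M := slice γ p.2 p.1

variable (E) in
/-- The part of the strip `ℝ × J` that `γ` maps to the domain of the chart at `x₀`. -/
def chartDomain (J : Set ℝ) (γ : Circle × ℝ → M) (x₀ : M) : Set (ℝ × ℝ) :=
  univ ×ˢ J ∩ flowMap γ ⁻¹' (extChartAt 𝓘(ℝ, E) x₀).source

variable (E) in
/-- The coordinates of the family of curves `γ` in the chart at `x₀`. -/
def flowCoord (γ : Circle × ℝ → M) (x₀ : M) (p : ℝ × ℝ) : E :=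
  extChartAt 𝓘(ℝ, E) x₀ (flowMap γ p)

variable (E) in
/-- The velocity of the curves of the family `γ` in the chart at `x₀`. -/
def velocityCoord (γ : Circle × ℝ → M) (x₀ : M) (p : ℝ × ℝ) : E :=
  coordField x₀ (slice γ p.2) (velocity (slice γ p.2)) p.1

variable (E) in
theorem mem_chartDomain (γ : Circle × ℝ → M) (hp : p.2 ∈ J) :
    p ∈ chartDomain E J γ (flowMap γ p) :=
  ⟨⟨mem_univ _, hp⟩, mem_extChartAt_source (I := 𝓘(ℝ, E)) (flowMap γ p)⟩

theorem mapsTo_flowCoord (x₀ : M) :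
    MapsTo (flowCoord E γ x₀) (chartDomain E J γ x₀) (extChartAt 𝓘(ℝ, E) x₀).target :=
  fun _ hp ↦ (extChartAt 𝓘(ℝ, E) x₀).map_source hp.2

section Smooth

variable (hγ : ContMDiffOn ((𝓡 1).prod 𝓘(ℝ, ℝ)) 𝓘(ℝ, E) ∞ γ (univ ×ˢ J))
include hγ

theorem contMDiffOn_flowMap :
    ContMDiffOn 𝓘(ℝ, ℝ × ℝ) 𝓘(ℝ, E) ∞ (flowMap γ) (univ ×ˢ J) := by
  have hfst : ContMDiff 𝓘(ℝ, ℝ × ℝ) 𝓘(ℝ, ℝ) ∞ (Prod.fst : ℝ × ℝ → ℝ) := contDiff_fst.contMDiff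
  have hsnd : ContMDiff 𝓘(ℝ, ℝ × ℝ) 𝓘(ℝ, ℝ) ∞ (Prod.snd : ℝ × ℝ → ℝ) := contDiff_snd.contMDiff
  exact hγ.comp ((contMDiff_circleExp.comp hfst).prodMk hsnd).contMDiffOn
    fun p hp ↦ ⟨mem_univ _, hp.2⟩

theorem mdifferentiable_slice {t : ℝ} (ht : t ∈ J) :
    MDifferentiable 𝓘(ℝ, ℝ) 𝓘(ℝ, E) (slice γ t) := by
  have hline : ContMDiff 𝓘(ℝ, ℝ) 𝓘(ℝ, ℝ × ℝ) ∞ (fun u : ℝ ↦ (u, t)) :=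
    (contDiff_id.prodMk contDiff_const).contMDiff
  have h : ContMDiffOn 𝓘(ℝ, ℝ) 𝓘(ℝ, E) ∞ (slice γ t) univ :=
    (contMDiffOn_flowMap hγ).comp hline.contMDiffOn fun u _ ↦ ⟨mem_univ _, ht⟩
  exact (contMDiffOn_univ.1 h).mdifferentiable (by simp)

theorem eventually_mem_chartDomain (hp : p ∈ chartDomain E J γ x₀) :
    ∀ᶠ u in nhds p.1, (u, p.2) ∈ chartDomain E J γ x₀ := by
  filter_upwards [((mdifferentiable_slice hγ hp.1.2).continuous.tendsto p.1)
    ((isOpen_extChartAt_source x₀).mem_nhds hp.2)] with u hu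
  exact ⟨⟨mem_univ _, hp.1.2⟩, hu⟩

theorem isOpen_chartDomain (hJ : IsOpen J) (x₀ : M) : IsOpen (chartDomain E J γ x₀) :=
  (contMDiffOn_flowMap hγ).continuousOn.isOpen_inter_preimage (isOpen_univ.prod hJ)
    (isOpen_extChartAt_source x₀)

theorem exists_isOpen_chartDomain_eq (x₀ : M) :
    ∃ W, IsOpen W ∧ chartDomain E J γ x₀ = univ ×ˢ J ∩ W := by
  obtain ⟨W, hW, h⟩ := continuousOn_iff'.1 (contMDiffOn_flowMap hγ).continuousOn _
    (isOpen_extChartAt_source (I := 𝓘(ℝ, E)) x₀)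
  exact ⟨W, hW, by rw [chartDomain, inter_comm, h, inter_comm]⟩

theorem uniqueDiffOn_chartDomain (hJ : UniqueDiffOn ℝ J) (x₀ : M) :
    UniqueDiffOn ℝ (chartDomain E J γ x₀) := by
  obtain ⟨W, hW, h⟩ := exists_isOpen_chartDomain_eq hγ x₀
  exact h ▸ (uniqueDiffOn_univ.prod hJ).inter hW

theorem chartDomain_mem_nhdsWithin (hp : p ∈ chartDomain E J γ x₀) :
    chartDomain E J γ x₀ ∈ nhdsWithin p (univ ×ˢ J) := by
  obtain ⟨W, hW, h⟩ := exists_isOpen_chartDomain_eq hγ x₀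
  rw [h] at hp ⊢
  exact inter_mem_nhdsWithin _ (hW.mem_nhds hp.2)

variable [IsManifold 𝓘(ℝ, E) ∞ M]

theorem contDiffOn_flowCoord (x₀ : M) :
    ContDiffOn ℝ ∞ (flowCoord E γ x₀) (chartDomain E J γ x₀) := by
  have hchart : ContMDiffOn 𝓘(ℝ, E) 𝓘(ℝ, E) ∞ (extChartAt 𝓘(ℝ, E) x₀)
      (extChartAt 𝓘(ℝ, E) x₀).source := by
    rw [extChartAt_source]
    exact contMDiffOn_extChartAt
  rw [← contMDiffOn_iff_contDiffOn]
  exact hchart.comp ((contMDiffOn_flowMap hγ).mono inter_subset_left) inter_subset_right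

theorem hasDerivAt_flowCoord (hp : p ∈ chartDomain E J γ x₀) :
    HasDerivAt (fun u ↦ flowCoord E γ x₀ (u, p.2)) (velocityCoord E γ x₀ p) p.1 :=
  hasDerivAt_extChartAt_comp (mdifferentiable_slice hγ hp.1.2 p.1) hp.2

theorem fderiv_flowCoord_fst (hd : DifferentiableAt ℝ (flowCoord E γ x₀) p)
    (hp : p ∈ chartDomain E J γ x₀) :
    fderiv ℝ (flowCoord E γ x₀) p (1, 0) = velocityCoord E γ x₀ p :=
  (hasDerivAt_fst hd).unique (hasDerivAt_flowCoord hγ hp)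

theorem contDiffOn_velocityCoord (hJ : UniqueDiffOn ℝ J) (x₀ : M) :
    ContDiffOn ℝ ∞ (velocityCoord E γ x₀) (chartDomain E J γ x₀) :=
  (contDiffOn_deriv_fst (contDiffOn_flowCoord hγ x₀) (uniqueDiffOn_chartDomain hγ hJ x₀)
    fun _ ↦ eventually_mem_chartDomain hγ).congr
      fun _ hp ↦ (hasDerivAt_flowCoord hγ hp).deriv.symm

end Smooth

variable [RiemannianBundle (fun x : M ↦ TangentSpace 𝓘(ℝ, E) x)]

variable (E) in
/-- The derivative `D^l T/∂s^l` in the chart at `x₀`. -/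
def tangentCoord (γ : Circle × ℝ → M) (x₀ : M) (l : ℕ) (p : ℝ × ℝ) : E :=
  coordField x₀ (slice γ p.2) (iterCovDerivT (slice γ p.2) l) p.1

variable (E) in
/-- The speed `v = |∂γ/∂u|` of the curves of the family `γ`. -/
def flowSpeed (γ : Circle × ℝ → M) (p : ℝ × ℝ) : ℝ :=
  ‖velocity (E := E) (slice γ p.2) p.1‖

theorem tangentCoord_zero (γ : Circle × ℝ → M) (x₀ : M) (p : ℝ × ℝ) :
    tangentCoord E γ x₀ 0 p = (flowSpeed E γ p)⁻¹ • velocityCoord E γ x₀ p :=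
  coordField_smul x₀ (slice γ p.2) (fun u ↦ ‖velocity (E := E) (slice γ p.2) u‖⁻¹)
    (velocity (slice γ p.2)) p.1

theorem iterCovDerivT_succ (c : ℝ → M) (l : ℕ) :
    iterCovDerivT (E := E) c (l + 1) = covDerivS c (iterCovDerivT c l) :=
  Function.iterate_succ_apply' _ _ _

namespace IsCurveShorteningFlow

theorem mono {I : Set ℝ} (h : IsCurveShorteningFlow E J γ) (hI : I ⊆ J) :
    IsCurveShorteningFlow E I γ where
  smooth := h.smooth.mono (prod_mono_right hI)
  immersed t ht := h.immersed t (hI ht)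
  evolution t ht u := (h.evolution t (hI ht) u).mono hI

theorem flowSpeed_pos (h : IsCurveShorteningFlow E J γ) (hp : p.2 ∈ J) : 0 < flowSpeed E γ p :=
  norm_pos_iff.2 (h.immersed p.2 hp p.1)

end IsCurveShorteningFlow

variable [IsManifold 𝓘(ℝ, E) ∞ M]

theorem IsCurveShorteningFlow.fderiv_flowCoord_snd (h : IsCurveShorteningFlow E J γ)
    (hJ : IsOpen J) (hd : DifferentiableAt ℝ (flowCoord E γ x₀) p) (hp : p ∈ chartDomain E J γ x₀) :
    fderiv ℝ (flowCoord E γ x₀) p (0, 1) = tangentCoord E γ x₀ 1 p := by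
  have hevolution := (hasDerivWithinAt_extChartAt_comp (h.evolution p.2 hp.1.2 p.1)
    hp.2).hasDerivAt (hJ.mem_nhds hp.1.2)
  refine ((hasDerivAt_snd hd).unique hevolution).trans ?_
  exact congrArg (chartD (E := E) x₀ _)
    (one_smul ℝ (iterCovDerivT (E := E) (slice γ p.2) 1 p.1))

theorem metric_tangentCoord (hp : p ∈ chartDomain E J γ x₀) (i j : ℕ) :
    metric x₀ (flowCoord E γ x₀ p) (tangentCoord E γ x₀ i p) (tangentCoord E γ x₀ j p) =
      inner ℝ (iterCovDerivT (E := E) (slice γ p.2) i p.1)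
        (iterCovDerivT (slice γ p.2) j p.1) :=
  metric_chartD hp.2 _ _

theorem metric_velocityCoord (hp : p ∈ chartDomain E J γ x₀) :
    metric x₀ (flowCoord E γ x₀ p) (velocityCoord E γ x₀ p) (velocityCoord E γ x₀ p) =
      flowSpeed E γ p ^ 2 :=
  (metric_chartD hp.2 _ _).trans (real_inner_self_eq_norm_sq _)

variable [FiniteDimensional ℝ E]
  [IsContMDiffRiemannianBundle 𝓘(ℝ, E) ∞ E (fun x : M ↦ TangentSpace 𝓘(ℝ, E) x)]

theorem contDiffOn_metric_flowCoord
    (hγ : ContMDiffOn ((𝓡 1).prod 𝓘(ℝ, ℝ)) 𝓘(ℝ, E) ∞ γ (univ ×ˢ J)) {V W : ℝ × ℝ → E}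
    (hV : ContDiffOn ℝ ∞ V (chartDomain E J γ x₀)) (hW : ContDiffOn ℝ ∞ W (chartDomain E J γ x₀)) :
    ContDiffOn ℝ ∞ (fun p ↦ metric x₀ (flowCoord E γ x₀ p) (V p) (W p)) (chartDomain E J γ x₀) :=
  (((isMetricOn_metric x₀).contDiffOn.comp (contDiffOn_flowCoord hγ x₀)
    (mapsTo_flowCoord x₀)).clm_apply hV).clm_apply hW

namespace IsCurveShorteningFlow

theorem contDiffOn_flowSpeed (h : IsCurveShorteningFlow E J γ) (hJ : UniqueDiffOn ℝ J) (x₀ : M) :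
    ContDiffOn ℝ ∞ (flowSpeed E γ) (chartDomain E J γ x₀) := by
  have hvelocity := contDiffOn_velocityCoord h.smooth hJ x₀
  refine ((contDiffOn_metric_flowCoord h.smooth hvelocity hvelocity).sqrt fun p hp ↦ ?_).congr
    fun p hp ↦ ?_
  · rw [metric_velocityCoord hp]
    exact (pow_pos (h.flowSpeed_pos hp.1.2) 2).ne'
  · rw [metric_velocityCoord hp, Real.sqrt_sq (h.flowSpeed_pos hp.1.2).le]

theorem tangentCoord_succ (h : IsCurveShorteningFlow E J γ) (hp : p ∈ chartDomain E J γ x₀) {l : ℕ}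
    (hl : DifferentiableAt ℝ (fun u ↦ tangentCoord E γ x₀ l (u, p.2)) p.1) :
    tangentCoord E γ x₀ (l + 1) p = (flowSpeed E γ p)⁻¹ •
      (deriv (fun u ↦ tangentCoord E γ x₀ l (u, p.2)) p.1 +
        christoffelMap (metric x₀) (flowCoord E γ x₀ p) (velocityCoord E γ x₀ p)
          (tangentCoord E γ x₀ l p)) := by
  have hcov := coordField_covDeriv (V := iterCovDerivT (slice γ p.2) l)
    (mdifferentiable_slice h.smooth hp.1.2 p.1) hp.2 hl
  rw [christoffelMap_metric, tangentCoord, iterCovDerivT_succ]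
  exact (coordField_smul x₀ (slice γ p.2) (fun u ↦ ‖velocity (E := E) (slice γ p.2) u‖⁻¹) _
    p.1).trans (congrArg _ hcov)

theorem contDiffOn_tangentCoord (h : IsCurveShorteningFlow E J γ) (hJ : UniqueDiffOn ℝ J) (x₀ : M)
    (l : ℕ) : ContDiffOn ℝ ∞ (tangentCoord E γ x₀ l) (chartDomain E J γ x₀) := by
  have hvelocity := contDiffOn_velocityCoord h.smooth hJ x₀
  have hinv : ContDiffOn ℝ ∞ (fun p ↦ (flowSpeed E γ p)⁻¹) (chartDomain E J γ x₀) :=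
    (h.contDiffOn_flowSpeed hJ x₀).inv fun p hp ↦ (h.flowSpeed_pos hp.1.2).ne'
  have hmem : ∀ p ∈ chartDomain E J γ x₀, ∀ᶠ u in nhds p.1, (u, p.2) ∈ chartDomain E J γ x₀ :=
    fun p ↦ eventually_mem_chartDomain h.smooth
  induction l with
  | zero => exact (hinv.smul hvelocity).congr fun p _ ↦ tangentCoord_zero γ x₀ p
  | succ l ih =>
    have hderiv := contDiffOn_deriv_fst ih (uniqueDiffOn_chartDomain h.smooth hJ x₀) hmem
    have hchristoffel := (((isMetricOn_metric x₀).contDiffOn_christoffelMap.comp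
      (contDiffOn_flowCoord h.smooth x₀) (mapsTo_flowCoord x₀)).clm_apply hvelocity).clm_apply ih
    exact (hinv.smul (hderiv.add hchristoffel)).congr fun p hp ↦
      h.tangentCoord_succ hp (hasDerivAt_fst_fderivWithin ih hp (hmem p hp)).differentiableAt

theorem isLocalFlow (h : IsCurveShorteningFlow E J γ) (hJ : IsOpen J)
    (hsymm : IsLocallySymmetric E M) (x₀ : M) :
    IsLocalFlow (metric x₀) (extChartAt 𝓘(ℝ, E) x₀).target (chartDomain E J γ x₀)
      (flowCoord E γ x₀) (flowSpeed E γ) (tangentCoord E γ x₀) := by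
  have hopen := isOpen_chartDomain h.smooth hJ x₀
  have hdiff : ∀ {f : ℝ × ℝ → E}, ContDiffOn ℝ ∞ f (chartDomain E J γ x₀) →
      ∀ p ∈ chartDomain E J γ x₀, DifferentiableAt ℝ f p := fun hf p hp ↦
    (hf.contDiffAt (hopen.mem_nhds hp)).differentiableAt (by simp)
  have hflow := contDiffOn_flowCoord h.smooth x₀
  have htangent := h.contDiffOn_tangentCoord hJ.uniqueDiffOn x₀
  have hpos : ∀ p ∈ chartDomain E J γ x₀, 0 < flowSpeed E γ p := fun p hp ↦
    h.flowSpeed_pos hp.1.2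
  exact
  { isMetricOn := isMetricOn_metric x₀
    hasParallelCurvatureOn := hsymm.hasParallelCurvatureOn x₀
    isOpen := hopen
    mapsTo := mapsTo_flowCoord x₀
    contDiffOn := hflow
    contDiffOn_speed := h.contDiffOn_flowSpeed hJ.uniqueDiffOn x₀
    speed_pos := hpos
    speed_smul_zero := fun p hp ↦ by
      rw [fderiv_flowCoord_fst h.smooth (hdiff hflow p hp) hp, tangentCoord_zero,
        smul_inv_smul₀ (hpos p hp).ne']
    unit := fun p hp ↦ by
      have hne := (hpos p hp).ne'
      simp only [tangentCoord_zero, map_smul, smul_apply, smul_eq_mul, metric_velocityCoord hp]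
      field_simp
    contDiffOn_coord := htangent
    speed_smul_succ := fun l p hp ↦ by
      have hfst := hasDerivAt_fst (hdiff (htangent l) p hp)
      rw [h.tangentCoord_succ hp hfst.differentiableAt, smul_inv_smul₀ (hpos p hp).ne', hfst.deriv,
        covD, fderiv_flowCoord_fst h.smooth (hdiff hflow p hp) hp]
    evolution := fun p hp ↦ h.fderiv_flowCoord_snd hJ (hdiff hflow p hp) hp }

end IsCurveShorteningFlow

end FlowCoordinates

section Periodicity

variable {E : Type*} [NormedAddCommGroup E] [NormedSpace ℝ E]
  {M : Type*} [TopologicalSpace M] [ChartedSpace E M] {c : ℝ → M}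

theorem velocity_comp_add_const (hc : MDifferentiable 𝓘(ℝ, ℝ) 𝓘(ℝ, E) c) (a u : ℝ) :
    velocity (E := E) (fun u ↦ c (u + a)) u = velocity c (u + a) := by
  have hshift : HasMFDerivAt 𝓘(ℝ, ℝ) 𝓘(ℝ, ℝ) (fun u : ℝ ↦ u + a) u
      (ContinuousLinearMap.id ℝ ℝ) := ((hasFDerivAt_id u).add_const a).hasMFDerivAt
  exact congr($(((hc (u + a)).hasMFDerivAt.comp u hshift).mfderiv) 1)

variable [RiemannianBundle (fun x : M ↦ TangentSpace 𝓘(ℝ, E) x)]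

theorem coordCovDeriv_comp_add_const (hc : MDifferentiable 𝓘(ℝ, ℝ) 𝓘(ℝ, E) c) (a : ℝ) (x₀ : M)
    (V : ∀ u, TangentSpace 𝓘(ℝ, E) (c u)) (u : ℝ) :
    coordCovDeriv x₀ (fun u ↦ c (u + a)) (fun u ↦ V (u + a)) u = coordCovDeriv x₀ c V (u + a) := by
  have hvelocity : coordField x₀ (fun u ↦ c (u + a)) (velocity fun u ↦ c (u + a)) u =
      coordField x₀ c (velocity c) (u + a) :=
    congrArg (chartD (E := E) x₀ (c (u + a))) (velocity_comp_add_const hc a u)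
  rw [coordCovDeriv, coordCovDeriv, hvelocity, ← deriv_comp_add_const]
  rfl

theorem covDerivS_comp_add_const (hc : MDifferentiable 𝓘(ℝ, ℝ) 𝓘(ℝ, E) c) (a : ℝ)
    (V : ∀ u, TangentSpace 𝓘(ℝ, E) (c u)) (u : ℝ) :
    covDerivS (E := E) (fun u ↦ c (u + a)) (fun u ↦ V (u + a)) u = covDerivS c V (u + a) := by
  have hvelocity := velocity_comp_add_const hc a u
  have hcoord := coordCovDeriv_comp_add_const hc a (c (u + a)) V u
  exact congr(‖$hvelocity‖⁻¹ • (chartD (E := E) (c (u + a)) (c (u + a))).inverse $hcoord)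

theorem iterCovDerivT_comp_add_const (hc : MDifferentiable 𝓘(ℝ, ℝ) 𝓘(ℝ, E) c) (a : ℝ) (l : ℕ) :
    iterCovDerivT (E := E) (fun u ↦ c (u + a)) l = fun u ↦ iterCovDerivT c l (u + a) := by
  induction l with
  | zero =>
    funext u
    have hvelocity := velocity_comp_add_const hc a u
    exact congr(‖$hvelocity‖⁻¹ • $hvelocity)
  | succ l ih =>
    funext u
    rw [iterCovDerivT_succ, iterCovDerivT_succ, ih]
    exact covDerivS_comp_add_const hc a _ u

end Periodicity

theorem uniqueDiffOn_of_lt {J : Set ℝ} (hJ : J.OrdConnected) {a b : ℝ} (ha : a ∈ J) (hb : b ∈ J)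
    (hab : a < b) : UniqueDiffOn ℝ J :=
  uniqueDiffOn_convex hJ.convex <| (nonempty_Ioo.2 hab).mono <|
    interior_maximal (Ioo_subset_Icc_self.trans (hJ.out ha hb)) isOpen_Ioo

section ScalarFlow

variable {E : Type*} [NormedAddCommGroup E] [NormedSpace ℝ E]
  {M : Type*} [TopologicalSpace M] [ChartedSpace E M]
  [RiemannianBundle (fun x : M ↦ TangentSpace 𝓘(ℝ, E) x)]

variable (E) in
/-- The inner products `⟨D^i T/∂s^i, D^j T/∂s^j⟩` along the family of curves `γ`. -/
def gram (γ : Circle × ℝ → M) (i j : ℕ) (u t : ℝ) : ℝ :=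
  inner ℝ (iterCovDerivT (E := E) (slice γ t) i u) (iterCovDerivT (E := E) (slice γ t) j u)

theorem gram_self (γ : Circle × ℝ → M) (l : ℕ) (u t : ℝ) :
    gram E γ l l u t = ‖iterCovDerivT (E := E) (slice γ t) l u‖ ^ 2 :=
  real_inner_self_eq_norm_sq _

variable {J : Set ℝ} {γ : Circle × ℝ → M} {p : ℝ × ℝ} {u t Λ : ℝ}

theorem periodic_gram
    (hγ : ContMDiffOn ((𝓡 1).prod 𝓘(ℝ, ℝ)) 𝓘(ℝ, E) ∞ γ (univ ×ˢ J)) (ht : t ∈ J) (i j : ℕ) :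
    Function.Periodic (fun u ↦ gram E γ i j u t) (2 * Real.pi) := by
  intro u
  have hslice : (fun u ↦ slice γ t (u + 2 * Real.pi)) = slice γ t :=
    funext fun u ↦ by rw [slice, slice, Circle.periodic_exp u]
  have hcongr : ∀ c : ℝ → M, c = slice γ t →
      inner ℝ (iterCovDerivT (E := E) c i u) (iterCovDerivT (E := E) c j u) = gram E γ i j u t := by
    rintro _ rfl
    rfl
  have h := iterCovDerivT_comp_add_const (mdifferentiable_slice hγ ht) (2 * Real.pi)
  refine Eq.trans ?_ (hcongr _ hslice)
  rw [h i, h j]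
  rfl

variable [IsManifold 𝓘(ℝ, E) ∞ M]

theorem eqOn_gram (γ : Circle × ℝ → M) (x₀ : M) (i j : ℕ) :
    EqOn (fun p ↦ gram E γ i j p.1 p.2) (fun p ↦ metric x₀ (flowCoord E γ x₀ p)
      (tangentCoord E γ x₀ i p) (tangentCoord E γ x₀ j p)) (chartDomain E J γ x₀) :=
  fun _ hp ↦ (metric_tangentCoord hp i j).symm

theorem IsCurveShorteningFlow.fderiv_gram (h : IsCurveShorteningFlow E J γ) (hJ : IsOpen J)
    (hp : p.2 ∈ J) (i j : ℕ) :
    fderiv ℝ (fun p : ℝ × ℝ ↦ gram E γ i j p.1 p.2) p =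
      fderiv ℝ (fun q ↦ metric (flowMap γ p) (flowCoord E γ (flowMap γ p) q)
        (tangentCoord E γ (flowMap γ p) i q) (tangentCoord E γ (flowMap γ p) j q)) p :=
  ((eqOn_gram γ (flowMap γ p) i j).eventuallyEq_of_mem
    ((isOpen_chartDomain h.smooth hJ _).mem_nhds (mem_chartDomain E γ hp))).fderiv_eq

variable [FiniteDimensional ℝ E]
  [IsContMDiffRiemannianBundle 𝓘(ℝ, E) ∞ E (fun x : M ↦ TangentSpace 𝓘(ℝ, E) x)]

namespace IsCurveShorteningFlow

theorem contDiffOn_gram (h : IsCurveShorteningFlow E J γ) (hJ : UniqueDiffOn ℝ J) (x₀ : M)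
    (i j : ℕ) : ContDiffOn ℝ ∞ (fun p ↦ gram E γ i j p.1 p.2) (chartDomain E J γ x₀) :=
  (contDiffOn_metric_flowCoord h.smooth (h.contDiffOn_tangentCoord hJ x₀ i)
    (h.contDiffOn_tangentCoord hJ x₀ j)).congr (eqOn_gram γ x₀ i j)

theorem continuousOn_gram (h : IsCurveShorteningFlow E J γ) (hJ : UniqueDiffOn ℝ J) (i j : ℕ) :
    ContinuousOn (fun p : ℝ × ℝ ↦ gram E γ i j p.1 p.2) (univ ×ˢ J) := fun p hp ↦
  ((h.contDiffOn_gram hJ (flowMap γ p) i j).continuousOn p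
    (mem_chartDomain E γ hp.2)).mono_of_mem_nhdsWithin
      (chartDomain_mem_nhdsWithin h.smooth (mem_chartDomain E γ hp.2))

theorem differentiableAt_gram (h : IsCurveShorteningFlow E J γ) (hJ : IsOpen J) (hp : p.2 ∈ J)
    (i j : ℕ) : DifferentiableAt ℝ (fun p : ℝ × ℝ ↦ gram E γ i j p.1 p.2) p :=
  ((h.contDiffOn_gram hJ.uniqueDiffOn (flowMap γ p) i j).contDiffAt
    ((isOpen_chartDomain h.smooth hJ _).mem_nhds (mem_chartDomain E γ hp))).differentiableAt
      (by simp)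

theorem differentiableAt_flowSpeed (h : IsCurveShorteningFlow E J γ) (hJ : IsOpen J)
    (hp : p.2 ∈ J) : DifferentiableAt ℝ (flowSpeed E γ) p :=
  ((h.contDiffOn_flowSpeed hJ.uniqueDiffOn (flowMap γ p)).contDiffAt
    ((isOpen_chartDomain h.smooth hJ _).mem_nhds (mem_chartDomain E γ hp))).differentiableAt
      (by simp)

theorem isTangentGram_gram (h : IsCurveShorteningFlow E J γ) (hJ : IsOpen J)
    (hsymm : IsLocallySymmetric E M) (ht : t ∈ J) (u : ℝ) :
    IsTangentGram fun i j ↦ gram E γ i j u t := by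
  have hmem := mem_chartDomain E γ (p := (u, t)) ht
  have hgram := (h.isLocalFlow hJ hsymm (flowMap γ (u, t))).isTangentGram hmem
  simpa only [metric_tangentCoord hmem] using! hgram

theorem hasDerivAt_gram_fst (h : IsCurveShorteningFlow E J γ) (hJ : IsOpen J)
    (hsymm : IsLocallySymmetric E M) (ht : t ∈ J) (i j : ℕ) (u : ℝ) :
    HasDerivAt (fun u ↦ gram E γ i j u t)
      (flowSpeed E γ (u, t) * (gram E γ (i + 1) j u t + gram E γ i (j + 1) u t)) u := by
  have hmem := mem_chartDomain E γ (p := (u, t)) ht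
  refine (hasDerivAt_fst (h.differentiableAt_gram hJ (p := (u, t)) ht i j)).congr_deriv ?_
  rw [h.fderiv_gram hJ ht, (h.isLocalFlow hJ hsymm _).fderiv_gram_fst i j hmem,
    metric_tangentCoord hmem, metric_tangentCoord hmem]
  rfl

theorem exists_hasDerivAt_gram_snd (h : IsCurveShorteningFlow E J γ) (hJ : IsOpen J)
    (hsymm : IsLocallySymmetric E M) (hcond : ConditionLambda E M Λ) (ht : t ∈ J) (l : ℕ) (u : ℝ) :
    ∃ S, |S| ≤ reactionBound Λ (fun i j ↦ gram E γ i j u t) l ∧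
      HasDerivAt (fun t ↦ gram E γ l l u t) (2 * gram E γ (l + 2) l u t + 2 * S) t := by
  have hmem := mem_chartDomain E γ (p := (u, t)) ht
  have hlocal := h.isLocalFlow hJ hsymm (flowMap γ (u, t))
  have hbound := hlocal.abs_apply_evalSum_le (Λ := Λ)
    (fun y hy X Y Z W ↦ by rw [curvatureMap_metric hy]; exact hcond _ y hy X Y Z W)
    hmem l (reaction l)
  refine ⟨_, by simpa only [metric_tangentCoord hmem] using! hbound,
    (hasDerivAt_snd (h.differentiableAt_gram hJ (p := (u, t)) ht l l)).congr_deriv ?_⟩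
  rw [h.fderiv_gram hJ ht, hlocal.fderiv_gram_snd l hmem, metric_tangentCoord hmem]
  rfl

theorem isScalarFlow (h : IsCurveShorteningFlow E J γ) (hJ : UniqueDiffOn ℝ J)
    (hsymm : IsLocallySymmetric E M) (hcond : ConditionLambda E M Λ) :
    IsScalarFlow Λ J (gram E γ) (fun u t ↦ flowSpeed E γ (u, t)) := by
  have hinterior := h.mono interior_subset
  exact
  { continuousOn := fun l ↦ h.continuousOn_gram hJ l l
    periodic := fun l t ht ↦ periodic_gram h.smooth ht l l
    nonneg := fun l u t ↦ real_inner_self_nonneg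
    gram := fun t ht u ↦ hinterior.isTangentGram_gram isOpen_interior hsymm ht u
    speed_pos := fun t ht u ↦ hinterior.flowSpeed_pos (p := (u, t)) ht
    differentiableAt_speed := fun t ht u ↦ (hasDerivAt_fst (hinterior.differentiableAt_flowSpeed
      isOpen_interior (p := (u, t)) ht)).differentiableAt
    hasDerivAt_fst := fun i j t ht u ↦ hinterior.hasDerivAt_gram_fst isOpen_interior hsymm ht i j u
    hasDerivAt_snd := fun l t ht u ↦
      hinterior.exists_hasDerivAt_gram_snd isOpen_interior hsymm hcond ht l u }

theorem isShortTimeFlow (h : IsCurveShorteningFlow E J γ) (hsymm : IsLocallySymmetric E M)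
    (hcond : ConditionLambda E M Λ) (hΛ : 0 < Λ) (hJ : J.OrdConnected) {t₀ t₁ M₀ : ℝ}
    (ht₀ : t₀ ∈ J) (ht₁ : t₁ ∈ J) (hlt : t₀ < t₁)
    (hM₀ : ∀ u, ‖iterCovDerivT (E := E) (slice γ t₀) 1 u‖ ^ 2 ≤ M₀)
    (hle : t₁ ≤ t₀ + 1 / (2 * Λ) * Real.log (1 + Λ / (4 * M₀ + Λ + 1))) :
    IsShortTimeFlow Λ J (gram E γ) (fun u t ↦ flowSpeed E γ (u, t)) t₀ t₁ M₀ where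
  flow := h.isScalarFlow (uniqueDiffOn_of_lt hJ ht₀ ht₁ hlt) hsymm hcond
  pos := hΛ
  ordConnected := hJ
  left_mem := ht₀
  right_mem := ht₁
  initial u := (gram_self γ 1 u t₀).trans_le (hM₀ u)
  time_le := hle

end IsCurveShorteningFlow

end ScalarFlow

end CSF

end

theorem theorem6_general :
    ∃ c : ℕ → ℝ,
      ∀ (Λ : ℝ), 0 < Λ →
        ∀ (E : Type*) [NormedAddCommGroup E] [NormedSpace ℝ E] [FiniteDimensional ℝ E]
          (M : Type*) [TopologicalSpace M] [ChartedSpace E M] [IsManifold 𝓘(ℝ, E) ∞ M]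
          [RiemannianBundle (fun x : M ↦ TangentSpace 𝓘(ℝ, E) x)]
          [IsContMDiffRiemannianBundle 𝓘(ℝ, E) ∞ E (fun x : M ↦ TangentSpace 𝓘(ℝ, E) x)],
          CSF.IsLocallySymmetric E M → CSF.ConditionLambda E M Λ →
          ∀ (J : Set ℝ) (γ : Circle × ℝ → M), J.OrdConnected →
            CSF.IsCurveShorteningFlow E J γ →
            ∀ t₀ ∈ J, ∀ M₀ : ℝ,
              (∀ u : ℝ, ‖CSF.iterCovDerivT (E := E) (CSF.slice γ t₀) 1 u‖ ^ 2 ≤ M₀) →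
              ∀ t ∈ J, t₀ < t →
                t ≤ t₀ + 1 / (2 * Λ) * Real.log (1 + Λ / (4 * M₀ + Λ + 1)) →
                ∀ u : ℝ,
                  (∀ l : ℕ, 1 ≤ l →
                    ‖CSF.iterCovDerivT (E := E) (CSF.slice γ t) l u‖ ^ 2
                      ≤ c l * M₀ / (t - t₀) ^ (l - 1)) ∧
                  ‖CSF.iterCovDerivT (E := E) (CSF.slice γ t) 1 u‖ ^ 2 ≤ 2 * M₀ := by
  refine ⟨fun l ↦ CSF.derivConst (l - 1), ?_⟩
  intro Λ hΛ E _ _ _ M _ _ _ _ _ hsymm hcond J γ hJ hγ t₀ ht₀ M₀ hM₀ t ht hlt hle u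
  have hflow := hγ.isShortTimeFlow hsymm hcond hΛ hJ ht₀ ht hlt hM₀ hle
  simp only [← CSF.gram_self]
  refine ⟨fun l hl ↦ ?_, hflow.curvature_le ⟨hlt.le, le_rfl⟩ u⟩
  obtain ⟨n, rfl⟩ := Nat.exists_eq_add_of_le' hl
  rw [Nat.add_sub_cancel, le_div_iff₀' (pow_pos (sub_pos.2 hlt) n)]
  exact hflow.deriv_bound n t ⟨hlt, le_rfl⟩ u n n.lt_succ_self

theorem theorem6 (Λ : ℝ) (hΛ : 0 < Λ) :
    ∃ c : ℕ → ℝ,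
      ∀ (E : Type*) [NormedAddCommGroup E] [NormedSpace ℝ E] [FiniteDimensional ℝ E]
        (M : Type*) [TopologicalSpace M] [T2Space M] [ChartedSpace E M]
        [IsManifold 𝓘(ℝ, E) ∞ M]
        [RiemannianBundle (fun x : M ↦ TangentSpace 𝓘(ℝ, E) x)]
        [IsContMDiffRiemannianBundle 𝓘(ℝ, E) ∞ E (fun x : M ↦ TangentSpace 𝓘(ℝ, E) x)],
        CSF.IsLocallySymmetric E M → CSF.ConditionLambda E M Λ →
        ∀ (J : Set ℝ) (γ : Circle × ℝ → M), J.OrdConnected →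
          CSF.IsCurveShorteningFlow E J γ →
          ∀ t₀ ∈ J, ∀ M₀ : ℝ,
            IsGreatest
              (range fun u : ℝ ↦ ‖CSF.iterCovDerivT (E := E) (CSF.slice γ t₀) 1 u‖ ^ 2) M₀ →
            ∀ t ∈ J, t₀ < t →
              t ≤ t₀ + 1 / (2 * Λ) * Real.log (1 + Λ / (4 * M₀ + Λ + 1)) →
              ∀ u : ℝ,
                (∀ l : ℕ, 1 ≤ l →
                  ‖CSF.iterCovDerivT (E := E) (CSF.slice γ t) l u‖ ^ 2
                    ≤ c l * M₀ / (t - t₀) ^ (l - 1)) ∧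
                ‖CSF.iterCovDerivT (E := E) (CSF.slice γ t) 1 u‖ ^ 2 ≤ 2 * M₀ := by
  obtain ⟨c, h⟩ := theorem6_general
  exact ⟨c, fun E _ _ _ M _ _ _ _ _ _ hsymm hcond J γ hJ hγ t₀ ht₀ M₀ hM₀ ↦
    h Λ hΛ E M hsymm hcond J γ hJ hγ t₀ ht₀ M₀ fun u ↦ hM₀.2 ⟨u, rfl⟩⟩
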